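/- Let $\mathcal S$ be a quantum system with finite-dimensional complex Hilbert space $\mathfrak h_{\mathcal S}$ and self-adjoint Hamiltonian $h_{\mathcal S}$, and let $\mathcal B^1(\mathfrak h_{\mathcal S})$ be the space of trace class operators on $\mathfrak h_{\mathcal S}$ (that is, all linear operators, since $\dim\mathfrak h_{\mathcal S}<\infty$). A state of $\mathcal S$ is a positive operator of trace one. A linear map $\mathcal L:\mathcal B^1(\mathfrak h_{\mathcal S})\to\mathcal B^1(\mathfrak h_{\mathcal S})$ is a *reduced dynamics map* (RDM) if there are a Hilbert space $\mathfrak h_{\mathcal E}$, a self-adjoint Hamiltonian $h_{\mathcal E}$ on it, an interaction operator $v$ on $\mathfrak h_{\mathcal S}\otimes\mathfrak h_{\mathcal E}$ (symmetric, and such that $h=h_{\mathcal S}\otimes 1+1\otimes h_{\mathcal E}+v$ is essentially self-adjoint), a time $\tau>0$ and a density operator $\rho_{\mathcal E}$ on $\mathfrak h_{\mathcal E}$ which is invariant under the free dynamics $e^{-\mathrm i t h_{\mathcal E}}$, such that for every $\rho$ $$\mathcal L(\rho)=\mathrm{Tr}_{\mathfrak h_{\mathcal E}}\left[e^{-\mathrm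 i\tau h}\,(\rho\otimes\rho_{\mathcal E})\,e^{\mathrm i\tau h}\right].$$ A linear map $\mathcal L$ on $\mathcal B^1(\mathfrak h_{\mathcal S})$ satisfies **(E)** if its spectrum on the complex unit circle consists of the single eigenvalue $1$ and this eigenvalue is (algebraically) simple. Let $\mathcal M_{(E)}$ be the set of RDMs that satisfy (E). Let $(\Omega_0,\mathcal F,\mathrm p)$ be a probability space, let $\Omega=\Omega_0^{\mathbb N^*}$ carry the product measure $\mathbb P=\prod_{j\ge1}\mathrm p$, and let $\omega_0\mapsto\mathcal L(\omega_0)$ be a measurable map on $\Omega_0$ whose values are RDMs. For $\omega=(\omega_n)_{n\ge1}\in\Omega$ and an initial state $\rho$ put $$\rho(n,\omega)=\big(\mathcal L(\omega_n)\circ\cdots\circ\mathcal L(\omega_1)\big)(\rho).$$ **Theorem.** Suppose that $\mathrm p(\mathcal L(\omega_0)\in\mathcal M_{(E)})>0$. Then: 1. $\mathcal L$ is $\mathrm p$-integrable and its mean $\mathbb E(\mathcal L)=\int_{\Omega_0}\mathcal L(\omega_0)\,d\mathrm p(\omega_0)$ satisfies (E). 2. $\mathbb E(\mathcal L)$ has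 a unique invariant state $\rho_{\mathcal S,+}$, and there is a measurable set $\tilde\Omega\subset\Omega$ with $\mathbb P(\tilde\Omega)=1$ such that for every $\omega\in\tilde\Omega$ and every initial state $\rho$ $$\lim_{N\to\infty}\frac1N\sum_{n=1}^N\rho(n,\omega)=\rho_{\mathcal S,+}.$$ -/

import Mathlib

open Filter Topology MeasureTheory
open scoped TensorProduct

set_option maxSynthPendingDepth 3

universe u v

namespace RepeatedInteraction

/-! ### Unitary propagators and unbounded Hamiltonians -/

section Propagator

variable {E : Type*} [NormedAddCommGroup E] [InnerProductSpace ℂ E]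

/-- `U` is the one-parameter group `t ↦ exp (-i t T)`: a strongly continuous one-parameter unitary
group whose (full) generator is `T`, i.e. `T x = i (d/dt) U t x` at `t = 0`, the domain of `T` being
exactly the set of those `x` for which the derivative exists. By Stone's theorem, on a Hilbert space
such a group exists if and only if `T` is self-adjoint, and it is then unique. -/
structure IsPropagator (U : ℝ → E ≃ₗᵢ[ℂ] E) (T : E →ₗ.[ℂ] E) : Prop where
  map_zero : ∀ x, U 0 x = x
  map_add : ∀ s t x, U (s + t) x = U s (U t x)
  continuous : ∀ x, Continuous fun t => U t x
  generator : ∀ x y, (x, y) ∈ T.graph ↔ HasDerivAt (fun t => U t x) (-Complex.I • y) 0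

/-- Density operators (states) on a Hilbert space of arbitrary dimension: positive operators of
trace one, the trace being computed in every orthonormal basis. -/
structure IsDensityOperator (ρ : E →L[ℂ] E) : Prop where
  isPositive : ρ.IsPositive
  hasTrace_one : ∀ (w : Set E) (b : HilbertBasis w ℂ E), HasSum (fun i => inner ℂ (b i) (ρ (b i))) 1

end Propagator

section Tensor

variable (H : Type*) [NormedAddCommGroup H] [InnerProductSpace ℂ H]
variable {K : Type*} [NormedAddCommGroup K] [InnerProductSpace ℂ K]

/-- `1 ⊗ T` on `H ⊗ K`, with domain `H ⊗ dom T`, for a possibly unbounded operator `T` on `K`. -/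
noncomputable def idTensor (T : K →ₗ.[ℂ] K) : (H ⊗[ℂ] K) →ₗ.[ℂ] (H ⊗[ℂ] K) where
  domain := LinearMap.range (T.domain.subtype.lTensor H)
  toFun := (T.toFun.lTensor H) ∘ₗ
    (LinearEquiv.ofInjective (T.domain.subtype.lTensor H)
      (Module.Flat.lTensor_preserves_injective_linearMap (M := H) T.domain.subtype
        T.domain.injective_subtype)).symm.toLinearMap

variable {H}

/-- `S ⊗ 1` on `H ⊗ K`, with full domain, for an everywhere defined operator `S` on `H`. -/
noncomputable def tensorId (K : Type*) [NormedAddCommGroup K] [InnerProductSpace ℂ K]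
    (S : H →ₗ[ℂ] H) : (H ⊗[ℂ] K) →ₗ.[ℂ] (H ⊗[ℂ] K) :=
  (S.rTensor K).toPMap ⊤

/-- The operator `A` on `H` is the partial trace over `K` of the operator `T` on `H ⊗ K`:
`⟪x, A y⟫ = ∑ i, ⟪x ⊗ b i, T (y ⊗ b i)⟫` for every orthonormal basis `b` of `K`. -/
def HasPartialTrace (T : (H ⊗[ℂ] K) →L[ℂ] (H ⊗[ℂ] K)) (A : H →L[ℂ] H) : Prop :=
  ∀ (w : Set K) (b : HilbertBasis w ℂ K) (x y : H),
    HasSum (fun i => inner ℂ (x ⊗ₜ[ℂ] b i) (T (y ⊗ₜ[ℂ] b i))) (inner ℂ x (A y))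

end Tensor

/-! ### Reduced dynamics maps -/

variable {H : Type u} [NormedAddCommGroup H] [InnerProductSpace ℂ H]

/-- One interaction of the small system (Hilbert space `H`, Hamiltonian `hS`) with a subsystem of
the environment. The total Hamiltonian `hS ⊗ 1 + 1 ⊗ hE + V` is essentially self-adjoint (that is,
its closure generates a unitary group) and the reference state of the subsystem is invariant
under the free dynamics of the subsystem. -/
structure Interaction (hS : H →ₗ[ℂ] H) where
  /-- the Hilbert space of the subsystem -/
  K : Type v
  [instNormedAddCommGroup : NormedAddCommGroup K]
  [instInnerProductSpace : InnerProductSpace ℂ K]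
  [instCompleteSpace : CompleteSpace K]
  /-- the (possibly unbounded) Hamiltonian of the subsystem -/
  hE : K →ₗ.[ℂ] K
  hE_selfAdjoint : IsSelfAdjoint hE
  /-- the free dynamics `exp (-i t hE)` of the subsystem -/
  freeU : ℝ → K ≃ₗᵢ[ℂ] K
  freeU_isPropagator : IsPropagator freeU hE
  /-- the (possibly unbounded) interaction operator -/
  V : (H ⊗[ℂ] K) →ₗ.[ℂ] (H ⊗[ℂ] K)
  V_symmetric : V.IsFormalAdjoint V
  /-- the coupled dynamics `exp (-i t h)`, where `h = hS ⊗ 1 + 1 ⊗ hE + V` -/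
  U : ℝ → (H ⊗[ℂ] K) ≃ₗᵢ[ℂ] (H ⊗[ℂ] K)
  U_isPropagator : IsPropagator U (tensorId K hS + idTensor H hE + V).closure
  /-- the duration of the interaction -/
  τ : ℝ
  τ_pos : 0 < τ
  /-- the reference state of the subsystem -/
  ρE : K →L[ℂ] K
  ρE_isDensityOperator : IsDensityOperator ρE
  ρE_invariant : ∀ t x, freeU t (ρE x) = ρE (freeU t x)

attribute [instance] Interaction.instNormedAddCommGroup Interaction.instInnerProductSpace
  Interaction.instCompleteSpace

/-- The operator `exp (-i τ h) (ρ ⊗ ρE) exp (i τ h)` on `H ⊗ K`. -/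
noncomputable def Interaction.evolve {hS : H →ₗ[ℂ] H} (I : Interaction.{u, v} hS)
    (ρ : H →L[ℂ] H) : (H ⊗[ℂ] I.K) →L[ℂ] (H ⊗[ℂ] I.K) :=
  ((I.U I.τ).toContinuousLinearEquiv : (H ⊗[ℂ] I.K) →L[ℂ] (H ⊗[ℂ] I.K)) ∘L
    (TensorProduct.mapL ρ I.ρE) ∘L
    ((I.U I.τ).symm.toContinuousLinearEquiv : (H ⊗[ℂ] I.K) →L[ℂ] (H ⊗[ℂ] I.K))

/-- `L` is a reduced dynamics map of the small system with Hamiltonian `hS`: for some interaction,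
`L ρ = Tr_K [exp (-i τ h) (ρ ⊗ ρE) exp (i τ h)]` for every `ρ`. As `H` will be finite dimensional,
`H →L[ℂ] H` is the space of trace class operators on `H` (with an equivalent norm). -/
def IsReducedDynamicsMap (hS : H →ₗ[ℂ] H) (L : (H →L[ℂ] H) →L[ℂ] (H →L[ℂ] H)) : Prop :=
  ∃ I : Interaction.{u, v} hS, ∀ ρ : H →L[ℂ] H, HasPartialTrace (I.evolve ρ) (L ρ)

/-- The ergodicity condition (E): the spectrum of `L` on the unit circle consists of the single
eigenvalue `1`, and this eigenvalue is (algebraically) simple. -/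
def IsErgodic (L : (H →L[ℂ] H) →L[ℂ] (H →L[ℂ] H)) : Prop :=
  spectrum ℂ L ∩ Metric.sphere (0 : ℂ) 1 = {1} ∧
    Module.finrank ℂ
      (Module.End.maxGenEigenspace (L : (H →L[ℂ] H) →ₗ[ℂ] (H →L[ℂ] H)) 1) = 1

/-- The set of the reduced dynamics maps that satisfy (E). -/
def ergodicMaps (hS : H →ₗ[ℂ] H) : Set ((H →L[ℂ] H) →L[ℂ] (H →L[ℂ] H)) :=
  {L | IsReducedDynamicsMap.{u, v} hS L ∧ IsErgodic L}

/-- States of the small (finite dimensional) system: positive operators with trace one. -/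
def IsState (ρ : H →L[ℂ] H) : Prop :=
  ρ.IsPositive ∧ LinearMap.trace ℂ H (ρ : H →ₗ[ℂ] H) = 1

/-- The state after `n` interactions: `(L ω_n ∘ ⋯ ∘ L ω_1) ρ`, for `ω = (ω_1, ω_2, …)`. -/
noncomputable def stateAt {Ω₀ : Type*} (L : Ω₀ → (H →L[ℂ] H) →L[ℂ] (H →L[ℂ] H)) (ω : ℕ+ → Ω₀)
    (ρ : H →L[ℂ] H) : ℕ → (H →L[ℂ] H)
  | 0 => ρ
  | n + 1 => L (ω n.succPNat) (stateAt L ω ρ n)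

end RepeatedInteraction

/-! Reduced dynamics maps are positive and trace preserving
(`isReducedDynamicsMap_isPositiveTracePreserving`), and nothing else about them is used. Such maps
form a bounded, closed, convex semigroup, so `ptpNorm` is an equivalent norm in which all of them
are contractions. For them, (E) amounts to having no traceless eigenvector of unimodular eigenvalue.

For the mean F, pick an ergodic L₀ in the support of the law of L. Averaging over a small ball
around L₀ writes F = qA + (1 - q)B with q > 0 and A close to L₀. If x is traceless and F x = z x
with |z| = 1, the contraction property forces N(x) ≤ N(Aᵐ x), N being `ptpNorm`. Since q has dropped
out, A can tend to L₀; then m → ∞ gives x = 0 (`hasNoUnimodularEigenvector_integral`).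

For the trajectories, let Rₙ be the random product. The increments Rₙ₊₁ - F Rₙ = (L(ωₙ₊₁) - F) Rₙ
are bounded and orthogonal to the past, so they average to zero almost surely
(`ae_tendsto_average_increments_randomProduct`). As 1 - F is bounded below on traceless operators,
the averages of Rₙ ρ must converge to the fixed point (`tendsto_cesaro_of_tendsto_increments`). -/

namespace RepeatedInteraction

/-! ### Parseval's identity on a tensor product -/

section Parseval

variable {H K : Type*} [NormedAddCommGroup H] [InnerProductSpace ℂ H]
  [NormedAddCommGroup K] [InnerProductSpace ℂ K]

theorem tsum_ofReal_norm_inner_sq {κ : Type*} (b : HilbertBasis κ ℂ K) (x : K) :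
    ∑' j, ENNReal.ofReal (‖inner ℂ (b j) x‖ ^ 2) = ENNReal.ofReal (‖x‖ ^ 2) := by
  have h : HasSum (fun j => ‖inner ℂ (b j) x‖ ^ 2) (‖x‖ ^ 2) := by
    have h0 := Complex.hasSum_re (b.hasSum_inner_mul_inner x x)
    convert! h0 using 1
    · ext j
      rw [← inner_conj_symm x (b j), ← Complex.normSq_eq_conj_mul_self, Complex.ofReal_re,
        Complex.normSq_eq_norm_sq]
    · exact (inner_self_eq_norm_sq (𝕜 := ℂ) x).symm
  rw [← h.tsum_eq, ENNReal.ofReal_tsum_of_nonneg (fun _ => by positivity) h.summable]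

/-- As `H` has a finite basis, every tensor is a finite sum of `e l ⊗ c l`, which reduces the claim
to Parseval in `K`. Working in `ENNReal` allows sums to be exchanged without summability conditions.
-/
theorem tsum_ofReal_norm_inner_tmul_sq {ι κ : Type*} [Fintype ι] (e : OrthonormalBasis ι ℂ H)
    (b : HilbertBasis κ ℂ K) (z : H ⊗[ℂ] K) :
    ∑' k : ι × κ, ENNReal.ofReal (‖inner ℂ (e k.1 ⊗ₜ[ℂ] b k.2) z‖ ^ 2)
      = ENNReal.ofReal (‖z‖ ^ 2) := by
  classical
  obtain ⟨c, rfl⟩ := TensorProduct.eq_repr_basis_left (N := K) e.toBasis z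
  rw [Finsupp.sum_fintype _ _ (by simp)]
  simp only [OrthonormalBasis.coe_toBasis]
  have h1 : ∀ i (y : K), inner ℂ (e i ⊗ₜ[ℂ] y) (∑ l, e l ⊗ₜ[ℂ] c l) = inner ℂ y (c i) := by
    intro i y
    simp [inner_sum, orthonormal_iff_ite.mp e.orthonormal]
  have h2 : ‖∑ l, e l ⊗ₜ[ℂ] c l‖ ^ 2 = ∑ l, ‖c l‖ ^ 2 := by
    rw [← inner_self_eq_norm_sq (𝕜 := ℂ), sum_inner, map_sum]
    exact Finset.sum_congr rfl fun i _ => by rw [h1, inner_self_eq_norm_sq]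
  rw [ENNReal.tsum_prod', tsum_fintype, h2, ENNReal.ofReal_sum_of_nonneg (fun _ _ => by positivity)]
  refine Finset.sum_congr rfl fun i _ => ?_
  simp only [h1]
  exact tsum_ofReal_norm_inner_sq b (c i)

/-- The Hilbert–Schmidt norms of `S ∘ W⁻¹` and of `S` agree, for `W` unitary and `S` symmetric. -/
theorem tsum_ofReal_norm_comp_isometry_sq {ι κ : Type*} [Fintype ι] (e : OrthonormalBasis ι ℂ H)
    (b : HilbertBasis κ ℂ K) (W : (H ⊗[ℂ] K) ≃ₗᵢ[ℂ] (H ⊗[ℂ] K)) (S : (H ⊗[ℂ] K) →L[ℂ] (H ⊗[ℂ] K))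
    (hS : ∀ x y, inner ℂ (S x) y = inner ℂ x (S y)) :
    ∑' k : ι × κ, ENNReal.ofReal (‖S (W.symm (e k.1 ⊗ₜ[ℂ] b k.2))‖ ^ 2)
      = ∑' k : ι × κ, ENNReal.ofReal (‖S (e k.1 ⊗ₜ[ℂ] b k.2)‖ ^ 2) := by
  -- Expand every norm by Parseval, exchange the two sums, move `S` and `W` across the inner
  -- product, and resum.
  simp_rw [← fun k : ι × κ => tsum_ofReal_norm_inner_tmul_sq e b (S (W.symm (e k.1 ⊗ₜ[ℂ] b k.2)))]
  rw [ENNReal.tsum_comm]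
  congr 1 with l
  rw [← LinearIsometryEquiv.norm_map W (S (e l.1 ⊗ₜ[ℂ] b l.2)),
    ← tsum_ofReal_norm_inner_tmul_sq e b]
  congr 1 with k
  rw [← hS, ← LinearIsometryEquiv.inner_map_map W, LinearIsometryEquiv.apply_symm_apply,
    norm_inner_symm]

theorem inner_mapL_symm (A : H →L[ℂ] H) (B : K →L[ℂ] K)
    (hA : ∀ x y, inner ℂ (A x) y = inner ℂ x (A y))
    (hB : ∀ x y, inner ℂ (B x) y = inner ℂ x (B y)) (z w : H ⊗[ℂ] K) :
    inner ℂ (TensorProduct.mapL A B z) w = inner ℂ z (TensorProduct.mapL A B w) := by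
  induction z with
  | zero => simp
  | add a b ha hb => simp only [map_add, inner_add_left, ha, hb]
  | tmul x y =>
    induction w with
    | zero => simp
    | add a b ha hb => simp only [map_add, inner_add_right, ha, hb]
    | tmul x' y' => simp [hA, hB]

end Parseval

/-! ### Positive trace-preserving maps -/

variable {H : Type u} [NormedAddCommGroup H] [InnerProductSpace ℂ H]

/-- Positive trace-preserving linear maps on the operators on `H`. -/
structure IsPositiveTracePreserving (Φ : (H →L[ℂ] H) →L[ℂ] (H →L[ℂ] H)) : Prop where
  isPositive : ∀ ρ : H →L[ℂ] H, ρ.IsPositive → (Φ ρ).IsPositive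
  trace_eq : ∀ ρ : H →L[ℂ] H, LinearMap.trace ℂ H (Φ ρ : H →ₗ[ℂ] H)
    = LinearMap.trace ℂ H (ρ : H →ₗ[ℂ] H)

/-- The trace as a linear functional on bounded operators. -/
noncomputable def traceL (H : Type u) [NormedAddCommGroup H] [InnerProductSpace ℂ H] :
    (H →L[ℂ] H) →ₗ[ℂ] ℂ :=
  LinearMap.trace ℂ H ∘ₗ ContinuousLinearMap.coeLM ℂ

theorem traceL_apply (ρ : H →L[ℂ] H) : traceL H ρ = LinearMap.trace ℂ H (ρ : H →ₗ[ℂ] H) := rfl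

/-! ### Positive operators span all operators -/

section Decomposition

variable [CompleteSpace H]

/-- A self-adjoint operator is half the difference of `‖a‖ + a` and `‖a‖ - a`, which are both
positive. -/
theorem isPositive_norm_add (a : H →L[ℂ] H) (ha : IsSelfAdjoint a) :
    ((‖a‖ : ℂ) • (1 : H →L[ℂ] H) + a).IsPositive := by
  rw [← ContinuousLinearMap.nonneg_iff_isPositive]
  have := ha.neg_algebraMap_norm_le_self
  rw [← sub_nonneg, sub_neg_eq_add, Algebra.algebraMap_eq_smul_one] at this
  rw [add_comm]
  convert! this using 2

theorem isPositive_norm_sub (a : H →L[ℂ] H) (ha : IsSelfAdjoint a) :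
    ((‖a‖ : ℂ) • (1 : H →L[ℂ] H) - a).IsPositive := by
  have := isPositive_norm_add (-a) ha.neg
  rwa [norm_neg, ← sub_eq_add_neg] at this

theorem eq_of_eq_on_isPositive {F : Type*} [AddCommGroup F] [Module ℂ F]
    (f g : (H →L[ℂ] H) →ₗ[ℂ] F) (h : ∀ ρ : H →L[ℂ] H, ρ.IsPositive → f ρ = g ρ) : f = g := by
  have hsa : ∀ a : H →L[ℂ] H, IsSelfAdjoint a → f a = g a := by
    intro a ha
    have hP := h _ (isPositive_norm_add a ha)
    have hM := h _ (isPositive_norm_sub a ha)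
    rw [map_add, map_add] at hP
    rw [map_sub, map_sub] at hM
    have h2 : (2 : ℂ) • f a = (2 : ℂ) • g a := by
      rw [two_smul, two_smul]
      have := congrArg₂ (· - ·) hP hM
      simpa [add_sub_sub_cancel] using this
    exact smul_right_injective F (two_ne_zero) h2
  ext a
  rw [← realPart_add_I_smul_imaginaryPart a]
  simp only [map_add, map_smul]
  rw [hsa _ (realPart a).2, hsa _ (imaginaryPart a).2]

end Decomposition

theorem isPositive_of_inner_eq_ofReal (A : H →L[ℂ] H) (r : H → ℝ) (hr : ∀ x, 0 ≤ r x)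
    (h : ∀ x, inner ℂ x (A x) = (r x : ℂ)) : A.IsPositive := by
  rw [ContinuousLinearMap.isPositive_iff_complex]
  intro x
  rw [← inner_conj_symm, h]
  simp [hr]

/-! ### Reduced dynamics maps are positive and trace preserving -/

section Evolution

variable {E : Type*} [NormedAddCommGroup E] [InnerProductSpace ℂ E] [CompleteSpace E]

theorem inner_sqrt_symm (T : E →L[ℂ] E) (x y : E) :
    inner ℂ (CFC.sqrt T x) y = inner ℂ x (CFC.sqrt T y) :=
  ((ContinuousLinearMap.nonneg_iff_isPositive _).1 (CFC.sqrt_nonneg T)).isSymmetric x y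

theorem sqrt_sqrt_apply {T : E →L[ℂ] E} (hT : T.IsPositive) (x : E) :
    CFC.sqrt T (CFC.sqrt T x) = T x := by
  rw [← mul_apply_eq_comp,
    CFC.sqrt_mul_sqrt_self T ((ContinuousLinearMap.nonneg_iff_isPositive T).2 hT)]

theorem inner_eq_norm_sqrt_sq {T : E →L[ℂ] E} (hT : T.IsPositive) (x : E) :
    inner ℂ x (T x) = ((‖CFC.sqrt T x‖ ^ 2 : ℝ) : ℂ) := by
  rw [← sqrt_sqrt_apply hT, ← inner_sqrt_symm, inner_self_eq_norm_sq_to_K]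
  push_cast
  rfl

theorem IsDensityOperator.tsum_norm_sqrt_sq {T : E →L[ℂ] E} (hT : IsDensityOperator T) {w : Set E}
    (b : HilbertBasis w ℂ E) : ∑' i, ENNReal.ofReal (‖CFC.sqrt T (b i)‖ ^ 2) = 1 := by
  have h := hT.2 w b
  simp only [inner_eq_norm_sqrt_sq hT.1] at h
  have h' := Complex.hasSum_re h
  simp only [Complex.ofReal_re, Complex.one_re] at h'
  rw [← ENNReal.ofReal_tsum_of_nonneg (fun _ => by positivity) h'.summable, h'.tsum_eq,
    ENNReal.ofReal_one]

variable [CompleteSpace H]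

/-- `A ⊗ B` is the square of the symmetric operator `√A ⊗ √B`. Written as squares, diagonal elements
are visibly nonnegative and can be summed by Hilbert–Schmidt identities. -/
theorem inner_conj_mapL (W : (H ⊗[ℂ] E) ≃ₗᵢ[ℂ] (H ⊗[ℂ] E)) {A : H →L[ℂ] H} (hA : A.IsPositive)
    {B : E →L[ℂ] E} (hB : B.IsPositive) (z : H ⊗[ℂ] E) :
    inner ℂ z (W (TensorProduct.mapL A B (W.symm z))) =
      ((‖TensorProduct.mapL (CFC.sqrt A) (CFC.sqrt B) (W.symm z)‖ ^ 2 : ℝ) : ℂ) := by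
  have hSS : ∀ y, TensorProduct.mapL A B y = TensorProduct.mapL (CFC.sqrt A) (CFC.sqrt B)
      (TensorProduct.mapL (CFC.sqrt A) (CFC.sqrt B) y) := by
    intro y
    induction y with
    | zero => simp
    | add a b ha hb => simp only [map_add, ← ha, ← hb]
    | tmul x' y' => simp only [TensorProduct.mapL_tmul, sqrt_sqrt_apply hA, sqrt_sqrt_apply hB]
  rw [hSS, ← LinearIsometryEquiv.inner_map_map W.symm, LinearIsometryEquiv.symm_apply_apply,
    ← inner_mapL_symm _ _ (inner_sqrt_symm A) (inner_sqrt_symm B), inner_self_eq_norm_sq_to_K]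
  push_cast
  rfl

/-- Unitary invariance of the Hilbert–Schmidt norm removes `W`; the rest factorizes, and `B`
contributes its trace, 1. -/
theorem sum_tsum_norm_mapL_sqrt_sq {ι : Type*} [Fintype ι] (e : OrthonormalBasis ι ℂ H) {w : Set E}
    (b : HilbertBasis w ℂ E) (W : (H ⊗[ℂ] E) ≃ₗᵢ[ℂ] (H ⊗[ℂ] E)) (A : H →L[ℂ] H)
    {B : E →L[ℂ] E} (hB : IsDensityOperator B) :
    ∑ j, ∑' i, ENNReal.ofReal (‖TensorProduct.mapL (CFC.sqrt A) (CFC.sqrt B)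
        (W.symm (e j ⊗ₜ[ℂ] b i))‖ ^ 2) =
      ∑ j, ENNReal.ofReal (‖CFC.sqrt A (e j)‖ ^ 2) := by
  have hU := tsum_ofReal_norm_comp_isometry_sq e b W _
    (inner_mapL_symm _ _ (inner_sqrt_symm A) (inner_sqrt_symm B))
  rw [ENNReal.tsum_prod', tsum_fintype, ENNReal.tsum_prod', tsum_fintype] at hU
  rw [hU]
  refine Finset.sum_congr rfl fun j _ => ?_
  simp only [TensorProduct.mapL_tmul, TensorProduct.norm_tmul, mul_pow,
    ENNReal.ofReal_mul (sq_nonneg _), ENNReal.tsum_mul_left, hB.tsum_norm_sqrt_sq, mul_one]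

end Evolution

/-- For positive `ρ`, the partial trace expresses each diagonal element of `L ρ` as a sum of
squares, whence positivity; summed over a basis of `H`, these give a Hilbert–Schmidt norm equal to
the trace of `ρ`. Linearity extends the trace identity to all operators. -/
theorem isReducedDynamicsMap_isPositiveTracePreserving [FiniteDimensional ℂ H] {hS : H →ₗ[ℂ] H}
    {L : (H →L[ℂ] H) →L[ℂ] (H →L[ℂ] H)} (hL : IsReducedDynamicsMap.{u, v} hS L) :
    IsPositiveTracePreserving L := by
  have : CompleteSpace H := FiniteDimensional.complete ℂ H
  obtain ⟨I, hI⟩ := hL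
  obtain ⟨w, b, -⟩ := exists_hilbertBasis ℂ I.K
  let e := stdOrthonormalBasis ℂ H
  let B := CFC.sqrt I.ρE
  have hsum : ∀ ρ : H →L[ℂ] H, ρ.IsPositive → ∀ x,
      HasSum (fun i => ‖TensorProduct.mapL (CFC.sqrt ρ) B ((I.U I.τ).symm (x ⊗ₜ[ℂ] b i))‖ ^ 2)
        (inner ℂ x (L ρ x)).re ∧ (inner ℂ x (L ρ x)).im = 0 := by
    intro ρ hρ x
    have h : HasSum (fun i => ((‖TensorProduct.mapL (CFC.sqrt ρ) B
        ((I.U I.τ).symm (x ⊗ₜ[ℂ] b i))‖ ^ 2 : ℝ) : ℂ)) (inner ℂ x (L ρ x)) :=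
      (hI ρ w b x x).congr_fun fun i =>
        (inner_conj_mapL (I.U I.τ) hρ I.ρE_isDensityOperator.1 (x ⊗ₜ[ℂ] b i)).symm
    have h' := Complex.hasSum_re h
    simp only [Complex.ofReal_re] at h'
    refine ⟨h', ?_⟩
    have h'' := Complex.hasSum_im h
    simp only [Complex.ofReal_im] at h''
    exact h''.unique hasSum_zero
  have hre : ∀ ρ : H →L[ℂ] H, ρ.IsPositive → ∀ x,
      inner ℂ x (L ρ x) = ((inner ℂ x (L ρ x)).re : ℂ) := fun ρ hρ x =>
    Complex.ext rfl (by simpa using (hsum ρ hρ x).2)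
  have hnn : ∀ ρ : H →L[ℂ] H, ρ.IsPositive → ∀ x, 0 ≤ (inner ℂ x (L ρ x)).re := fun ρ hρ x =>
    (hsum ρ hρ x).1.nonneg fun i => by positivity
  have hpos : ∀ ρ : H →L[ℂ] H, ρ.IsPositive → (L ρ).IsPositive := fun ρ hρ =>
    isPositive_of_inner_eq_ofReal _ _ (hnn ρ hρ) (hre ρ hρ)
  have htr : ∀ ρ : H →L[ℂ] H, ρ.IsPositive → LinearMap.trace ℂ H (L ρ : H →ₗ[ℂ] H)
      = LinearMap.trace ℂ H (ρ : H →ₗ[ℂ] H) := by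
    intro ρ hρ
    have hU := sum_tsum_norm_mapL_sqrt_sq e b (I.U I.τ) ρ I.ρE_isDensityOperator
    have hL' : ∀ j, ∑' i, ENNReal.ofReal
        (‖TensorProduct.mapL (CFC.sqrt ρ) B ((I.U I.τ).symm (e j ⊗ₜ[ℂ] b i))‖ ^ 2)
        = ENNReal.ofReal (inner ℂ (e j) (L ρ (e j))).re := by
      intro j
      have h := (hsum ρ hρ (e j)).1
      rw [← ENNReal.ofReal_tsum_of_nonneg (fun _ => by positivity) h.summable, h.tsum_eq]
    rw [Finset.sum_congr rfl fun j _ => hL' j,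
      ← ENNReal.ofReal_sum_of_nonneg (fun j _ => hnn ρ hρ (e j)),
      ← ENNReal.ofReal_sum_of_nonneg (fun j _ => by positivity),
      ENNReal.ofReal_eq_ofReal_iff (Finset.sum_nonneg fun j _ => hnn ρ hρ (e j))
        (Finset.sum_nonneg fun j _ => by positivity)] at hU
    rw [LinearMap.trace_eq_sum_inner _ e, LinearMap.trace_eq_sum_inner _ e]
    simp only [ContinuousLinearMap.coe_coe]
    rw [Finset.sum_congr rfl fun j _ => hre ρ hρ (e j),
      Finset.sum_congr rfl fun j _ => inner_eq_norm_sqrt_sq hρ (e j)]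
    exact_mod_cast congrArg (fun r : ℝ => (r : ℂ)) hU
  refine ⟨hpos, fun ρ => ?_⟩
  have := eq_of_eq_on_isPositive (traceL H ∘ₗ (L : (H →L[ℂ] H) →ₗ[ℂ] (H →L[ℂ] H))) (traceL H) htr
  exact LinearMap.congr_fun this ρ

end RepeatedInteraction

namespace RepeatedInteraction

variable {H : Type u} [NormedAddCommGroup H] [InnerProductSpace ℂ H]

namespace IsPositiveTracePreserving

variable {Φ Ψ : (H →L[ℂ] H) →L[ℂ] (H →L[ℂ] H)}

theorem one : IsPositiveTracePreserving (1 : (H →L[ℂ] H) →L[ℂ] (H →L[ℂ] H)) :=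
  ⟨fun _ h => h, fun _ => rfl⟩

theorem mul (hΦ : IsPositiveTracePreserving Φ) (hΨ : IsPositiveTracePreserving Ψ) :
    IsPositiveTracePreserving (Φ * Ψ) :=
  ⟨fun ρ h => hΦ.isPositive _ (hΨ.isPositive ρ h),
    fun ρ => (hΦ.trace_eq (Ψ ρ)).trans (hΨ.trace_eq ρ)⟩

theorem pow (hΦ : IsPositiveTracePreserving Φ) : ∀ n : ℕ, IsPositiveTracePreserving (Φ ^ n)
  | 0 => by rw [pow_zero]; exact one
  | n + 1 => by rw [pow_succ]; exact (hΦ.pow n).mul hΦ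

theorem traceL_apply_eq (hΦ : IsPositiveTracePreserving Φ) (x : H →L[ℂ] H) :
    traceL H (Φ x) = traceL H x := hΦ.trace_eq x

end IsPositiveTracePreserving

/-! ### A norm for which every positive trace-preserving map is a contraction -/

/-- The supremum of `‖Φ x‖` over all positive trace-preserving maps `Φ`. -/
noncomputable def ptpNorm (x : H →L[ℂ] H) : ℝ :=
  ⨆ Φ : {Φ : (H →L[ℂ] H) →L[ℂ] (H →L[ℂ] H) // IsPositiveTracePreserving Φ}, ‖Φ.1 x‖

theorem ptpNorm_le {x : H →L[ℂ] H} {r : ℝ}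
    (h : ∀ Φ : (H →L[ℂ] H) →L[ℂ] (H →L[ℂ] H), IsPositiveTracePreserving Φ → ‖Φ x‖ ≤ r) :
    ptpNorm x ≤ r :=
  have : Nonempty {Φ : (H →L[ℂ] H) →L[ℂ] (H →L[ℂ] H) // IsPositiveTracePreserving Φ} :=
    ⟨⟨1, .one⟩⟩
  ciSup_le fun Φ => h Φ.1 Φ.2

variable [FiniteDimensional ℂ H]

/-- The trace is the squared Hilbert–Schmidt norm of `√ρ`, which dominates the squared operator norm
of `√ρ`. -/
theorem norm_le_re_trace {ρ : H →L[ℂ] H} (hρ : ρ.IsPositive) :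
    ‖ρ‖ ≤ (LinearMap.trace ℂ H (ρ : H →ₗ[ℂ] H)).re := by
  have : CompleteSpace H := FiniteDimensional.complete ℂ H
  let e := stdOrthonormalBasis ℂ H
  have htr : (LinearMap.trace ℂ H (ρ : H →ₗ[ℂ] H)).re = ∑ j, ‖CFC.sqrt ρ (e j)‖ ^ 2 := by
    rw [LinearMap.trace_eq_sum_inner _ e, Complex.re_sum]
    refine Finset.sum_congr rfl fun j _ => ?_
    rw [ContinuousLinearMap.coe_coe, inner_eq_norm_sqrt_sq hρ, Complex.ofReal_re]
  rw [htr]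
  have hle : ∀ x, ‖CFC.sqrt ρ x‖ ^ 2 ≤ (∑ j, ‖CFC.sqrt ρ (e j)‖ ^ 2) * ‖x‖ ^ 2 := by
    intro x
    rw [← e.sum_sq_norm_inner_right, Finset.sum_mul]
    refine Finset.sum_le_sum fun j _ => ?_
    rw [← inner_sqrt_symm, ← mul_pow]
    gcongr
    exact norm_inner_le_norm _ _
  have hnn : 0 ≤ ∑ j, ‖CFC.sqrt ρ (e j)‖ ^ 2 := Finset.sum_nonneg fun j _ => by positivity
  have hle' : ∀ x, ‖CFC.sqrt ρ x‖ ≤ √(∑ j, ‖CFC.sqrt ρ (e j)‖ ^ 2) * ‖x‖ := by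
    intro x
    rw [← Real.sqrt_sq (norm_nonneg x), ← Real.sqrt_mul hnn]
    exact Real.le_sqrt_of_sq_le (hle x)
  refine ContinuousLinearMap.opNorm_le_bound _ hnn fun x => ?_
  rw [← sqrt_sqrt_apply hρ]
  calc _ ≤ √(∑ j, ‖CFC.sqrt ρ (e j)‖ ^ 2) * ‖CFC.sqrt ρ x‖ := hle' _
    _ ≤ √(∑ j, ‖CFC.sqrt ρ (e j)‖ ^ 2) * (√(∑ j, ‖CFC.sqrt ρ (e j)‖ ^ 2) * ‖x‖) := by
      gcongr; exact hle' x
    _ = _ := by rw [← mul_assoc, Real.mul_self_sqrt hnn]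

namespace IsPositiveTracePreserving

variable {Φ Ψ : (H →L[ℂ] H) →L[ℂ] (H →L[ℂ] H)}

/-- The images of `‖a‖ + a` and `‖a‖ - a` are positive, so their norms are at most their traces,
which `Φ` preserves and which add up to `2 * dim H * ‖a‖`. -/
theorem norm_apply_le_of_isSelfAdjoint (hΦ : IsPositiveTracePreserving Φ) {a : H →L[ℂ] H}
    (ha : letI := FiniteDimensional.complete ℂ H; IsSelfAdjoint a) :
    ‖Φ a‖ ≤ Module.finrank ℂ H * ‖a‖ := by
  have : CompleteSpace H := FiniteDimensional.complete ℂ H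
  have hP := isPositive_norm_add a ha
  have hM := isPositive_norm_sub a ha
  have h1 := norm_le_re_trace (hΦ.isPositive _ hP)
  have h2 := norm_le_re_trace (hΦ.isPositive _ hM)
  rw [hΦ.trace_eq, ← traceL_apply, map_add (traceL H), map_smul (traceL H)] at h1
  rw [hΦ.trace_eq, ← traceL_apply, map_sub (traceL H), map_smul (traceL H)] at h2
  have h1' : traceL H (1 : H →L[ℂ] H) = Module.finrank ℂ H := LinearMap.trace_one ℂ H
  rw [h1'] at h1 h2
  have e1 : (2 : ℂ) • Φ a = Φ ((‖a‖ : ℂ) • (1 : H →L[ℂ] H) + a)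
      - Φ ((‖a‖ : ℂ) • (1 : H →L[ℂ] H) - a) := by
    rw [← map_sub, add_sub_sub_cancel, map_add, two_smul]
  have h3 : 2 * ‖Φ a‖ ≤ ‖Φ ((‖a‖ : ℂ) • (1 : H →L[ℂ] H) + a)‖
      + ‖Φ ((‖a‖ : ℂ) • (1 : H →L[ℂ] H) - a)‖ := by
    have := norm_sub_le (Φ ((‖a‖ : ℂ) • (1 : H →L[ℂ] H) + a))
      (Φ ((‖a‖ : ℂ) • (1 : H →L[ℂ] H) - a))
    rw [← e1, norm_smul] at this
    simpa using this
  simp only [smul_eq_mul, Complex.add_re, Complex.sub_re, Complex.re_ofReal_mul,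
    Complex.natCast_re] at h1 h2
  linarith

theorem norm_apply_le (hΦ : IsPositiveTracePreserving Φ) (a : H →L[ℂ] H) :
    ‖Φ a‖ ≤ 2 * Module.finrank ℂ H * ‖a‖ := by
  have : CompleteSpace H := FiniteDimensional.complete ℂ H
  conv_lhs => rw [← realPart_add_I_smul_imaginaryPart a, map_add, map_smul]
  have h1 := hΦ.norm_apply_le_of_isSelfAdjoint (realPart a).2
  have h2 := hΦ.norm_apply_le_of_isSelfAdjoint (imaginaryPart a).2
  have h1' : ‖(realPart a : H →L[ℂ] H)‖ ≤ ‖a‖ := realPart.norm_le a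
  have h2' : ‖(imaginaryPart a : H →L[ℂ] H)‖ ≤ ‖a‖ := imaginaryPart.norm_le a
  calc _ ≤ ‖Φ (realPart a)‖ + ‖Φ (imaginaryPart a)‖ := by
        refine (norm_add_le _ _).trans_eq ?_
        rw [norm_smul, Complex.norm_I, one_mul]
    _ ≤ Module.finrank ℂ H * ‖a‖ + Module.finrank ℂ H * ‖a‖ := by
        gcongr
        · exact h1.trans (by gcongr)
        · exact h2.trans (by gcongr)
    _ = _ := by ring

theorem norm_le (hΦ : IsPositiveTracePreserving Φ) : ‖Φ‖ ≤ 2 * Module.finrank ℂ H :=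
  Φ.opNorm_le_bound (by positivity) hΦ.norm_apply_le

end IsPositiveTracePreserving

theorem isClosed_isPositive : IsClosed {ρ : H →L[ℂ] H | ρ.IsPositive} := by
  have : CompleteSpace H := FiniteDimensional.complete ℂ H
  simp_rw [ContinuousLinearMap.isPositive_iff_complex, Set.ofPred_forall]
  refine isClosed_iInter fun x => ?_
  have hc : Continuous fun ρ : H →L[ℂ] H => inner ℂ (ρ x) x := by fun_prop
  exact (isClosed_eq (Complex.continuous_ofReal.comp (Complex.continuous_re.comp hc)) hc).inter
    (isClosed_le continuous_const (Complex.continuous_re.comp hc))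

theorem continuous_traceL : Continuous (traceL H) := LinearMap.continuous_of_finiteDimensional _

theorem isClosed_isPositiveTracePreserving :
    IsClosed {Φ : (H →L[ℂ] H) →L[ℂ] (H →L[ℂ] H) | IsPositiveTracePreserving Φ} := by
  have h : {Φ : (H →L[ℂ] H) →L[ℂ] (H →L[ℂ] H) | IsPositiveTracePreserving Φ} =
      (⋂ ρ : {ρ : H →L[ℂ] H // ρ.IsPositive}, {Φ | (Φ ρ.1).IsPositive}) ∩
        ⋂ ρ : H →L[ℂ] H, {Φ | traceL H (Φ ρ) = traceL H ρ} := by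
    ext Φ
    simp only [Set.mem_ofPred_eq, Set.mem_inter_iff, Set.mem_iInter, Subtype.forall]
    exact ⟨fun h => ⟨h.1, h.2⟩, fun h => ⟨h.1, h.2⟩⟩
  rw [h]
  refine (isClosed_iInter fun ρ => ?_).inter (isClosed_iInter fun ρ => ?_)
  · exact isClosed_isPositive.preimage
      (f := fun Φ : (H →L[ℂ] H) →L[ℂ] (H →L[ℂ] H) => Φ ρ.1) (by fun_prop)
  · exact isClosed_eq (continuous_traceL.comp (by fun_prop)) continuous_const

theorem convex_isPositiveTracePreserving :
    Convex ℝ {Φ : (H →L[ℂ] H) →L[ℂ] (H →L[ℂ] H) | IsPositiveTracePreserving Φ} := by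
  intro Φ hΦ Ψ hΨ a b ha hb hab
  have hsmul : ∀ {c : ℝ} {ρ : H →L[ℂ] H}, 0 ≤ c → ρ.IsPositive → (c • ρ).IsPositive := by
    intro c ρ hc hρ
    have := hρ.smul_of_nonneg (c := (c : ℂ)) (by exact_mod_cast hc)
    exact this
  refine ⟨fun ρ hρ => ?_, fun ρ => ?_⟩
  · exact (hsmul ha (hΦ.isPositive ρ hρ)).add (hsmul hb (hΨ.isPositive ρ hρ))
  · have hab' : (a : ℂ) + b = 1 := by exact_mod_cast hab
    have e : (a • Φ + b • Ψ) ρ = (a : ℂ) • Φ ρ + (b : ℂ) • Ψ ρ := rfl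
    rw [e, ← traceL_apply, ← traceL_apply, map_add, map_smul, map_smul, hΦ.traceL_apply_eq,
      hΨ.traceL_apply_eq, ← add_smul, hab', one_smul]

theorem norm_apply_le_ptpNorm {Φ : (H →L[ℂ] H) →L[ℂ] (H →L[ℂ] H)}
    (hΦ : IsPositiveTracePreserving Φ) (x : H →L[ℂ] H) : ‖Φ x‖ ≤ ptpNorm x :=
  le_ciSup (f := fun Φ : {Φ : (H →L[ℂ] H) →L[ℂ] (H →L[ℂ] H) // IsPositiveTracePreserving Φ} =>
    ‖Φ.1 x‖) ⟨_, by rintro _ ⟨Ψ, rfl⟩; exact Ψ.2.norm_apply_le x⟩ ⟨Φ, hΦ⟩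

theorem norm_le_ptpNorm (x : H →L[ℂ] H) : ‖x‖ ≤ ptpNorm x := norm_apply_le_ptpNorm .one x

theorem ptpNorm_le_mul_norm (x : H →L[ℂ] H) : ptpNorm x ≤ 2 * Module.finrank ℂ H * ‖x‖ :=
  ptpNorm_le fun _ hΦ => hΦ.norm_apply_le x

/-- Each `Ψ * Φ` already occurs in the supremum defining `ptpNorm x`. -/
theorem IsPositiveTracePreserving.ptpNorm_apply_le {Φ : (H →L[ℂ] H) →L[ℂ] (H →L[ℂ] H)}
    (hΦ : IsPositiveTracePreserving Φ) (x : H →L[ℂ] H) : ptpNorm (Φ x) ≤ ptpNorm x :=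
  ptpNorm_le fun _ hΨ => norm_apply_le_ptpNorm (hΨ.mul hΦ) x

theorem ptpNorm_add_le (x y : H →L[ℂ] H) : ptpNorm (x + y) ≤ ptpNorm x + ptpNorm y :=
  ptpNorm_le fun Φ hΦ => by
    rw [map_add]
    exact (norm_add_le _ _).trans
      (add_le_add (norm_apply_le_ptpNorm hΦ x) (norm_apply_le_ptpNorm hΦ y))

theorem ptpNorm_smul (c : ℂ) (x : H →L[ℂ] H) : ptpNorm (c • x) = ‖c‖ * ptpNorm x := by
  simp only [ptpNorm, map_smul, norm_smul]
  exact (Real.mul_iSup_of_nonneg (norm_nonneg c) _).symm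

theorem continuous_ptpNorm : Continuous (ptpNorm (H := H)) := by
  have h : ∀ x y : H →L[ℂ] H, ptpNorm x ≤ ptpNorm y + 2 * Module.finrank ℂ H * dist x y := by
    intro x y
    have := ptpNorm_add_le y (x - y)
    rw [add_sub_cancel] at this
    rw [dist_eq_norm]
    exact this.trans (by gcongr; exact ptpNorm_le_mul_norm _)
  exact (LipschitzWith.of_le_add_mul (2 * Module.finrank ℂ H) (by simpa using h)).continuous

end RepeatedInteraction

/-! ### Eigenvalues of maps between finite-dimensional spaces -/

section Spectrum

variable {E : Type*} [NormedAddCommGroup E] [NormedSpace ℂ E] [FiniteDimensional ℂ E]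

theorem mem_spectrum_iff_exists_eigenvector (T : E →L[ℂ] E) (z : ℂ) :
    z ∈ spectrum ℂ T ↔ ∃ x, x ≠ 0 ∧ T x = z • x := by
  have : CompleteSpace E := FiniteDimensional.complete ℂ E
  rw [ContinuousLinearMap.spectrum_eq, ← Module.End.hasEigenvalue_iff_mem_spectrum]
  constructor
  · intro hz
    obtain ⟨x, hx⟩ := hz.exists_hasEigenvector
    exact ⟨x, hx.2, hx.apply_eq_smul⟩
  · rintro ⟨x, hx0, hx⟩
    exact Module.End.hasEigenvalue_of_hasEigenvector ⟨Module.End.mem_eigenspace_iff.2 hx, hx0⟩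

/-- By Gelfand's formula, `‖a ^ n‖` is eventually at most `r ^ n` for some `r < 1`. -/
theorem tendsto_pow_zero_of_spectralRadius_lt_one {A : Type*} [NormedRing A] [NormedAlgebra ℂ A]
    [CompleteSpace A] {a : A} (h : spectralRadius ℂ a < 1) :
    Tendsto (fun n : ℕ => a ^ n) atTop (𝓝 0) := by
  obtain ⟨r, hr1, hr2⟩ := ENNReal.lt_iff_exists_nnreal_btwn.1 h
  have hr2' : (r : ℝ) < 1 := by exact_mod_cast hr2
  have hev := (spectrum.pow_nnnorm_pow_one_div_tendsto_nhds_spectralRadius a).eventually_lt_const hr1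
  refine squeeze_zero_norm' ?_ (tendsto_pow_atTop_nhds_zero_of_lt_one r.2 hr2')
  filter_upwards [hev, eventually_gt_atTop 0] with n hn hn0
  have h1 : ((‖a ^ n‖₊ : ENNReal) ^ (1 / n : ℝ)) ^ n ≤ (r : ENNReal) ^ n := by gcongr
  rw [← ENNReal.rpow_natCast, ← ENNReal.rpow_mul, one_div,
    inv_mul_cancel₀ (by exact_mod_cast hn0.ne'), ENNReal.rpow_one] at h1
  exact_mod_cast h1

theorem tendsto_pow_apply_zero (T : E →L[ℂ] E) (h : ∀ (z : ℂ) x, 1 ≤ ‖z‖ → T x = z • x → x = 0)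
    (x : E) : Tendsto (fun n : ℕ => (T ^ n) x) atTop (𝓝 0) := by
  have : CompleteSpace E := FiniteDimensional.complete ℂ E
  -- The spectral radius bound needs a nonempty spectrum, so the zero space is treated apart.
  rcases subsingleton_or_nontrivial E with hE | hE
  · exact tendsto_const_nhds.congr fun n => Subsingleton.elim _ _
  have hr : spectralRadius ℂ T < ((1 : NNReal) : ENNReal) := by
    refine spectrum.spectralRadius_lt_of_forall_lt T fun z hz => ?_
    obtain ⟨x, hx0, hx⟩ := (mem_spectrum_iff_exists_eigenvector T z).1 hz
    by_contra! hz1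
    exact hx0 (h z x hz1 hx)
  have h0 := tendsto_pow_zero_of_spectralRadius_lt_one (by simpa using hr)
  have h1 := ((ContinuousLinearMap.apply ℂ E x).continuous.tendsto 0).comp h0
  rw [map_zero] at h1
  exact h1

end Spectrum

/-! ### Condition (E) and traceless unimodular eigenvectors -/

namespace RepeatedInteraction

variable {H : Type u} [NormedAddCommGroup H] [InnerProductSpace ℂ H]
  {F : (H →L[ℂ] H) →L[ℂ] (H →L[ℂ] H)}

/-- A map without eigenvectors of unimodular eigenvalue among the traceless operators. -/
def HasNoUnimodularEigenvector (F : (H →L[ℂ] H) →L[ℂ] (H →L[ℂ] H)) : Prop :=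
  ∀ (z : ℂ) (x : H →L[ℂ] H), ‖z‖ = 1 → traceL H x = 0 → F x = z • x → x = 0

theorem HasNoUnimodularEigenvector.eq_zero_of_fixed (h : HasNoUnimodularEigenvector F)
    {x : H →L[ℂ] H} (hx : traceL H x = 0) (hFx : F x = x) : x = 0 :=
  h 1 x norm_one hx (by rwa [one_smul])

variable [FiniteDimensional ℂ H]

theorem nontrivial_of_isErgodic (h : IsErgodic F) : Nontrivial H := by
  by_contra hH
  rw [not_nontrivial_iff_subsingleton] at hH
  have h1 : (1 : ℂ) ∈ spectrum ℂ F := (h.1.ge rfl).1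
  obtain ⟨x, hx, -⟩ := (mem_spectrum_iff_exists_eigenvector F 1).1 h1
  exact hx (Subsingleton.elim _ _)

theorem traceL_one : traceL H (1 : H →L[ℂ] H) = Module.finrank ℂ H := LinearMap.trace_one ℂ H

/-- Contractivity forces `‖z‖ = 1`, and (E) then forces `z = 1`. A nonzero `x` would span the
generalized eigenspace, so `D = F - 1` has kernel of dimension at most one and its range is the
whole traceless hyperplane. Thus `x = D y` with `D ^ 2` killing `y`; so `y` is a multiple of `x` and
`D y = 0`, a contradiction. Algebraic simplicity is what excludes this Jordan block. -/
theorem IsErgodic.eq_zero_of_apply_eq_smul (hE : IsErgodic F) (hF : IsPositiveTracePreserving F)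
    {z : ℂ} {x : H →L[ℂ] H} (hz : 1 ≤ ‖z‖) (hx : traceL H x = 0) (hFx : F x = z • x) : x = 0 := by
  by_contra hx0
  have hN : 0 < ptpNorm x := (norm_pos_iff.2 hx0).trans_le (norm_le_ptpNorm x)
  have hz1 : ‖z‖ = 1 := by
    have h := hF.ptpNorm_apply_le x
    rw [hFx, ptpNorm_smul] at h
    exact le_antisymm ((mul_le_iff_le_one_left hN).1 h) hz
  have hz' : z = 1 := by
    have : z ∈ spectrum ℂ F ∩ Metric.sphere (0 : ℂ) 1 :=
      ⟨(mem_spectrum_iff_exists_eigenvector F z).2 ⟨x, hx0, hFx⟩, by simpa using hz1⟩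
    rw [hE.1] at this
    exact this
  rw [hz', one_smul] at hFx
  have := nontrivial_of_isErgodic hE
  set G := Module.End.maxGenEigenspace (F : (H →L[ℂ] H) →ₗ[ℂ] (H →L[ℂ] H)) 1 with hG
  let D : (H →L[ℂ] H) →ₗ[ℂ] (H →L[ℂ] H) :=
    (F : (H →L[ℂ] H) →ₗ[ℂ] (H →L[ℂ] H)) - 1
  have hD : ∀ y, D y = F y - y := fun y => rfl
  have hmem : ∀ {y} (k : ℕ), (D ^ k) y = 0 → y ∈ G := by
    intro y k hk
    rw [hG, Module.End.mem_maxGenEigenspace]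
    refine ⟨k, ?_⟩
    rwa [one_smul]
  have hxG : x ∈ G := hmem 1 (by rw [pow_one, hD, hFx, sub_self])
  have hspan : ∀ y ∈ G, ∃ c : ℂ, c • x = y := by
    intro y hy
    obtain ⟨c, hc⟩ := (finrank_eq_one_iff_of_nonzero' (⟨x, hxG⟩ : G)
      (by simpa [Subtype.ext_iff] using hx0)).1 hE.2 ⟨y, hy⟩
    exact ⟨c, congrArg Subtype.val hc⟩
  have hDx : ∀ c : ℂ, D (c • x) = 0 := fun c => by rw [map_smul, hD, hFx, sub_self, smul_zero]
  have hker : Module.finrank ℂ (LinearMap.ker D) ≤ 1 := by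
    refine finrank_le_one (⟨x, by rw [LinearMap.mem_ker, hD, hFx, sub_self]⟩ : LinearMap.ker D) ?_
    rintro ⟨y, hy⟩
    obtain ⟨c, hc⟩ := hspan y (hmem 1 (by rwa [pow_one]))
    exact ⟨c, Subtype.ext hc⟩
  have hrange : LinearMap.range D ≤ LinearMap.ker (traceL H) := by
    rintro _ ⟨y, rfl⟩
    rw [LinearMap.mem_ker, hD, map_sub, hF.traceL_apply_eq, sub_self]
  have hlt : Module.finrank ℂ (LinearMap.ker (traceL H)) < Module.finrank ℂ (H →L[ℂ] H) := by
    refine Submodule.finrank_lt fun htop => ?_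
    have : (1 : H →L[ℂ] H) ∈ LinearMap.ker (traceL H) := htop ▸ Submodule.mem_top
    rw [LinearMap.mem_ker, traceL_one] at this
    exact Module.finrank_pos.ne' (by exact_mod_cast this)
  have hrk := D.finrank_range_add_finrank_ker
  have heq := Submodule.eq_of_le_of_finrank_le hrange (by omega)
  obtain ⟨y, hy⟩ : x ∈ LinearMap.range D := heq ▸ hx
  obtain ⟨c, hc⟩ := hspan y (hmem 2 (by
    rw [pow_two, Module.End.mul_apply, hy, hD, hFx, sub_self]))
  exact hx0 (by rw [← hy, ← hc, hDx])

/-- Powers of an ergodic map vanish asymptotically on traceless operators. -/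
theorem IsErgodic.tendsto_pow_apply_zero (hE : IsErgodic F) (hF : IsPositiveTracePreserving F)
    {x : H →L[ℂ] H} (hx : traceL H x = 0) :
    Tendsto (fun n : ℕ => (F ^ n) x) atTop (𝓝 0) := by
  let T : LinearMap.ker (traceL H) →L[ℂ] LinearMap.ker (traceL H) :=
    (F ∘L (LinearMap.ker (traceL H)).subtypeL).codRestrict _ fun y => by
      rw [LinearMap.mem_ker]
      exact (hF.traceL_apply_eq _).trans y.2
  have hT : ∀ n y, (((T ^ n) y : LinearMap.ker (traceL H)) : H →L[ℂ] H) = (F ^ n) y := by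
    intro n
    induction n with
    | zero => intro y; rfl
    | succ n ih => intro y; rw [pow_succ, pow_succ]; exact ih (T y)
  have h := _root_.tendsto_pow_apply_zero T (fun z y hz hy => Subtype.ext
    (hE.eq_zero_of_apply_eq_smul hF hz y.2 (congrArg Subtype.val hy))) ⟨x, hx⟩
  have h' := (continuous_subtype_val.tendsto _).comp h
  exact h'.congr fun n => hT n _

/-- On the traceless operators `F - 1` is injective, hence surjective, so a traceless correction
turns the maximally mixed state into a fixed point. -/
theorem exists_fixed_of_trace_one [Nontrivial H] (hF : IsPositiveTracePreserving F)
    (h : HasNoUnimodularEigenvector F) : ∃ ρ : H →L[ℂ] H, traceL H ρ = 1 ∧ F ρ = ρ := by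
  let D : (H →L[ℂ] H) →ₗ[ℂ] (H →L[ℂ] H) := (F : (H →L[ℂ] H) →ₗ[ℂ] (H →L[ℂ] H)) - 1
  have hD : ∀ y, D y = F y - y := fun y => rfl
  have htr : ∀ y, traceL H (D y) = 0 := fun y => by
    rw [hD, map_sub, hF.traceL_apply_eq, sub_self]
  let T : LinearMap.ker (traceL H) →ₗ[ℂ] LinearMap.ker (traceL H) :=
    D.restrict fun y _ => htr y
  have hinj : Function.Injective T := by
    rw [← LinearMap.ker_eq_bot, LinearMap.ker_eq_bot']
    intro y hy
    have : F y - y = 0 := congrArg Subtype.val hy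
    exact Subtype.ext (h.eq_zero_of_fixed y.2 (sub_eq_zero.1 this))
  let ρ₀ : H →L[ℂ] H := (Module.finrank ℂ H : ℂ)⁻¹ • 1
  have hρ₀ : traceL H ρ₀ = 1 := by
    rw [map_smul, traceL_one, smul_eq_mul, inv_mul_cancel₀]
    exact_mod_cast Module.finrank_pos.ne'
  obtain ⟨y, hy⟩ := LinearMap.injective_iff_surjective.1 hinj ⟨D ρ₀, htr ρ₀⟩
  have hy' : F y - y = F ρ₀ - ρ₀ := congrArg Subtype.val hy
  refine ⟨ρ₀ - y, ?_, ?_⟩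
  · rw [map_sub, hρ₀, show traceL H (y : H →L[ℂ] H) = 0 from y.2, sub_zero]
  · rw [map_sub, sub_eq_sub_iff_sub_eq_sub]
    exact hy'.symm

/-- Trace preservation makes eigenvectors for `z ≠ 1` traceless. A generalized eigenvector `y` for 1
differs from `traceL H y • ρ` by a traceless one, which vanishes because `F - 1` is injective there.
-/
theorem isErgodic_of_hasNoUnimodularEigenvector [Nontrivial H] (hF : IsPositiveTracePreserving F)
    (h : HasNoUnimodularEigenvector F) : IsErgodic F := by
  obtain ⟨ρ, hρ1, hρ⟩ := exists_fixed_of_trace_one hF h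
  have hρ0 : ρ ≠ 0 := by
    rintro rfl
    simp at hρ1
  refine ⟨Set.Subset.antisymm ?_ ?_, ?_⟩
  · rintro z ⟨hz, hz1⟩
    obtain ⟨x, hx0, hx⟩ := (mem_spectrum_iff_exists_eigenvector F z).1 hz
    have htr := hF.traceL_apply_eq x
    rw [hx, map_smul, smul_eq_mul] at htr
    by_contra hne
    refine hx0 (h z x (by simpa using hz1) ?_ hx)
    by_contra ht
    exact hne (mul_eq_right₀ ht |>.1 htr)
  · rintro _ rfl
    exact ⟨(mem_spectrum_iff_exists_eigenvector F 1).2 ⟨ρ, hρ0, by rw [one_smul, hρ]⟩, by simp⟩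
  · let D : (H →L[ℂ] H) →ₗ[ℂ] (H →L[ℂ] H) := (F : (H →L[ℂ] H) →ₗ[ℂ] (H →L[ℂ] H)) - 1
    have hD : ∀ y, D y = F y - y := fun y => rfl
    have hDk : ∀ (k : ℕ) y, traceL H y = 0 → (D ^ k) y = 0 → y = 0 := by
      intro k
      induction k with
      | zero => intro y _ hy; exact hy
      | succ k ih =>
        intro y hty hy
        rw [pow_succ, Module.End.mul_apply] at hy
        have := ih (D y) (by rw [hD, map_sub, hF.traceL_apply_eq, sub_self]) hy
        exact h.eq_zero_of_fixed hty (sub_eq_zero.1 this)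
    have hmem : ∀ y, y ∈ Module.End.maxGenEigenspace (F : (H →L[ℂ] H) →ₗ[ℂ] (H →L[ℂ] H)) 1 ↔
        ∃ k : ℕ, (D ^ k) y = 0 := by
      intro y
      rw [Module.End.mem_maxGenEigenspace, one_smul]
    have hρG : D ρ = 0 := by rw [hD, hρ, sub_self]
    rw [finrank_eq_one_iff_of_nonzero' ⟨ρ, (hmem ρ).2 ⟨1, by rwa [pow_one]⟩⟩
      (by simpa [Subtype.ext_iff] using hρ0)]
    rintro ⟨y, hy⟩
    obtain ⟨k, hk⟩ := (hmem y).1 hy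
    refine ⟨traceL H y, Subtype.ext (sub_eq_zero.1 ?_)⟩
    -- The exponent `k + 1` covers `k = 0`, since `D ^ 0` does not kill `ρ`.
    refine hDk (k + 1) _ (by simp [hρ1]) ?_
    change (D ^ (k + 1)) (traceL H y • ρ - y) = 0
    rw [map_sub, map_smul, pow_succ, Module.End.mul_apply, hρG, map_zero, smul_zero, zero_sub,
      ← pow_succ, pow_succ', Module.End.mul_apply, hk, map_zero, neg_zero]

end RepeatedInteraction

namespace RepeatedInteraction

variable {H : Type u} [NormedAddCommGroup H] [InnerProductSpace ℂ H] [FiniteDimensional ℂ H]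
  {F A B : (H →L[ℂ] H) →L[ℂ] (H →L[ℂ] H)}

/-! ### Convex combinations with a map close to an ergodic one -/

/-- In the expansion of `F ^ m` into words in `A` and `B`, only the word `A ^ m`, of weight `q ^ m`,
is kept; contractivity bounds all others. -/
theorem ptpNorm_convexCombination_pow_le (hA : IsPositiveTracePreserving A)
    (hB : IsPositiveTracePreserving B) (hF : IsPositiveTracePreserving F) {q : ℝ} (hq0 : 0 ≤ q)
    (hq1 : q ≤ 1) (hFAB : F = q • A + (1 - q) • B) (m : ℕ) (x : H →L[ℂ] H) :
    ptpNorm ((F ^ m) x) ≤ q ^ m * ptpNorm ((A ^ m) x) + (1 - q ^ m) * ptpNorm x := by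
  induction m generalizing x with
  | zero => simp
  | succ m ih =>
    have e : (F ^ (m + 1)) x = (q : ℂ) • (F ^ m) (A x) + ((1 - q : ℝ) : ℂ) • (F ^ m) (B x) := by
      have : F x = (q : ℂ) • A x + ((1 - q : ℝ) : ℂ) • B x := by
        conv_lhs => rw [hFAB]
        rfl
      rw [← map_smul (F ^ m), ← map_smul (F ^ m), ← map_add, ← this, pow_succ]
      rfl
    have h1 : 0 ≤ 1 - q := by linarith
    have hqm : 0 ≤ 1 - q ^ m := by linarith [pow_le_one₀ hq0 hq1 (n := m)]
    have hAx := hA.ptpNorm_apply_le x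
    have hBx := ((hF.pow m).ptpNorm_apply_le (B x)).trans (hB.ptpNorm_apply_le x)
    rw [e]
    refine (ptpNorm_add_le _ _).trans ?_
    rw [ptpNorm_smul, ptpNorm_smul, Complex.norm_of_nonneg hq0, Complex.norm_of_nonneg h1]
    have e2 : (A ^ (m + 1)) x = (A ^ m) (A x) := by rw [pow_succ]; rfl
    rw [e2]
    calc _ ≤ q * (q ^ m * ptpNorm ((A ^ m) (A x)) + (1 - q ^ m) * ptpNorm x)
          + (1 - q) * ptpNorm x := by
          gcongr
          exact (ih (A x)).trans (by gcongr)
      _ = _ := by ring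

/-- Here `F ^ m` preserves the norm of `x`, so the `1 - q ^ m` term cancels and `q ^ m > 0` can be
divided out. The bound is independent of `q`. -/
theorem ptpNorm_le_pow_apply (hA : IsPositiveTracePreserving A) (hB : IsPositiveTracePreserving B)
    (hF : IsPositiveTracePreserving F) {q : ℝ} (hq0 : 0 < q) (hq1 : q ≤ 1)
    (hFAB : F = q • A + (1 - q) • B) {z : ℂ} (hz : ‖z‖ = 1) {x : H →L[ℂ] H} (hx : F x = z • x)
    (m : ℕ) : ptpNorm x ≤ ptpNorm ((A ^ m) x) := by
  have hm : (F ^ m) x = z ^ m • x := by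
    induction m with
    | zero => simp
    | succ m ih =>
      have : (F ^ (m + 1)) x = (F ^ m) (F x) := by rw [pow_succ]; rfl
      rw [this, hx, map_smul, ih, smul_smul, pow_succ']
  have h := ptpNorm_convexCombination_pow_le hA hB hF hq0.le hq1 hFAB m x
  rw [hm, ptpNorm_smul, norm_pow, hz, one_pow, one_mul] at h
  have hqm : 0 < q ^ m := pow_pos hq0 m
  by_contra! hlt
  nlinarith

/-! ### The mean of a random positive trace-preserving map -/

section Mean

variable {Ω₀ : Type*} [MeasurableSpace Ω₀] {p : Measure Ω₀} [IsProbabilityMeasure p]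
  {L : Ω₀ → (H →L[ℂ] H) →L[ℂ] (H →L[ℂ] H)}

theorem integrable_of_isPositiveTracePreserving (hL : Measurable L)
    (hP : ∀ ω, IsPositiveTracePreserving (L ω)) : Integrable L p :=
  Integrable.of_bound hL.aestronglyMeasurable (2 * Module.finrank ℂ H)
    (ae_of_all _ fun ω => (hP ω).norm_le)

theorem integral_mem_of_convex {s : Set ((H →L[ℂ] H) →L[ℂ] (H →L[ℂ] H))} (hs : Convex ℝ s)
    (hsc : IsClosed s) (hi : Integrable L p) (hL : ∀ᵐ ω ∂p, L ω ∈ s) : ∫ ω, L ω ∂p ∈ s :=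
  hs.integral_mem hsc hL hi

theorem setAverage_mem_of_convex {s : Set ((H →L[ℂ] H) →L[ℂ] (H →L[ℂ] H))} (hs : Convex ℝ s)
    (hsc : IsClosed s) (hi : Integrable L p) {t : Set Ω₀} (ht : p t ≠ 0)
    (hL : ∀ᵐ ω ∂p.restrict t, L ω ∈ s) : ⨍ ω in t, L ω ∂p ∈ s :=
  hs.set_average_mem hsc ht (measure_ne_top p t) hL hi.integrableOn

theorem isPositiveTracePreserving_integral (hL : Measurable L)
    (hP : ∀ ω, IsPositiveTracePreserving (L ω)) : IsPositiveTracePreserving (∫ ω, L ω ∂p) := by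
  have h : ∀ᵐ ω ∂p, IsPositiveTracePreserving (L ω) := Eventually.of_forall hP
  exact integral_mem_of_convex convex_isPositiveTracePreserving isClosed_isPositiveTracePreserving
    (integrable_of_isPositiveTracePreserving hL hP) h

theorem isPositiveTracePreserving_setAverage (hL : Measurable L)
    (hP : ∀ ω, IsPositiveTracePreserving (L ω)) {t : Set Ω₀} (ht : p t ≠ 0) :
    IsPositiveTracePreserving (⨍ ω in t, L ω ∂p) := by
  have h : ∀ᵐ ω ∂p.restrict t, IsPositiveTracePreserving (L ω) := Eventually.of_forall hP
  exact setAverage_mem_of_convex convex_isPositiveTracePreserving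
    isClosed_isPositiveTracePreserving (integrable_of_isPositiveTracePreserving hL hP) ht h

theorem integral_eq_convexCombination (hL : Measurable L)
    (hP : ∀ ω, IsPositiveTracePreserving (L ω)) {s : Set Ω₀} (hsm : MeasurableSet s) :
    ∃ B, IsPositiveTracePreserving B ∧
      ∫ ω, L ω ∂p = p.real s • (⨍ ω in s, L ω ∂p) + (1 - p.real s) • B := by
  have hi : Integrable L p := integrable_of_isPositiveTracePreserving hL hP
  rw [← integral_add_compl hsm hi, ← measure_smul_setAverage L (measure_ne_top p s)]
  -- The average over a null set is zero, which need not preserve the trace; the weight of `B` is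
  -- then 0 and the identity serves.
  by_cases hc : p sᶜ = 0
  · refine ⟨1, .one, ?_⟩
    have h1 : p.real s = 1 := by
      rw [measureReal_def, (prob_compl_eq_zero_iff hsm).1 hc, ENNReal.toReal_one]
    rw [Measure.restrict_eq_zero.2 hc, integral_zero_measure, h1, sub_self, zero_smul]
  · refine ⟨_, isPositiveTracePreserving_setAverage hL hP hc, ?_⟩
    rw [← measure_smul_setAverage L (measure_ne_top p sᶜ), probReal_compl_eq_one_sub hsm]

theorem hasNoUnimodularEigenvector_integral (hL : Measurable L)
    (hP : ∀ ω, IsPositiveTracePreserving (L ω)) (hpos : 0 < p {ω | IsErgodic (L ω)}) :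
    HasNoUnimodularEigenvector (∫ ω, L ω ∂p) := by
  intro z x hz hx hzx
  have hi : Integrable L p := integrable_of_isPositiveTracePreserving hL hP
  let S : Set ((H →L[ℂ] H) →L[ℂ] (H →L[ℂ] H)) := {Φ | IsPositiveTracePreserving Φ ∧ IsErgodic Φ}
  have hS : p.map L S ≠ 0 := by
    refine (hpos.trans_le ?_).ne'
    -- This inequality does not require `S` to be measurable.
    refine le_trans (measure_mono fun ω hω => ?_) (Measure.le_map_apply hL.aemeasurable S)
    exact ⟨hP ω, hω⟩
  obtain ⟨L₀, hL₀, hnhds⟩ := exists_mem_forall_mem_nhdsWithin_pos_measure hS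
  have hball : ∀ n : ℕ, p (L ⁻¹' Metric.closedBall L₀ (1 / ((n : ℝ) + 1))) ≠ 0 := by
    intro n
    rw [← Measure.map_apply hL measurableSet_closedBall]
    exact (hnhds _ (mem_nhdsWithin_of_mem_nhds
      (Metric.closedBall_mem_nhds L₀ Nat.one_div_pos_of_nat))).ne'
  let A : ℕ → (H →L[ℂ] H) →L[ℂ] (H →L[ℂ] H) := fun n =>
    ⨍ ω in L ⁻¹' Metric.closedBall L₀ (1 / ((n : ℝ) + 1)), L ω ∂p
  have hA : ∀ n, IsPositiveTracePreserving (A n) := fun n =>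
    isPositiveTracePreserving_setAverage hL hP (hball n)
  have hAm : ∀ n : ℕ, A n ∈ Metric.closedBall L₀ (1 / ((n : ℝ) + 1)) := fun n =>
    setAverage_mem_of_convex (convex_closedBall L₀ _) Metric.isClosed_closedBall hi (hball n)
      (ae_restrict_of_forall_mem (hL measurableSet_closedBall) fun ω hω => hω)
  have hAlim : Tendsto A atTop (𝓝 L₀) :=
    tendsto_iff_dist_tendsto_zero.2 <| squeeze_zero (fun _ => dist_nonneg) hAm
      tendsto_one_div_add_atTop_nhds_zero_nat
  have hle : ∀ n m, ptpNorm x ≤ ptpNorm ((A n ^ m) x) := by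
    intro n m
    obtain ⟨B, hB, hAB⟩ := integral_eq_convexCombination (p := p) hL hP
      (hL (measurableSet_closedBall (x := L₀) (ε := 1 / ((n : ℝ) + 1))))
    exact ptpNorm_le_pow_apply (hA n) hB (isPositiveTracePreserving_integral hL hP)
      (ENNReal.toReal_pos (hball n) (measure_ne_top _ _)) measureReal_le_one hAB hz hzx m
  -- The limit in `n` comes first, at fixed `m`: only the powers of `L₀` are known to decay.
  have hle' : ∀ m, ptpNorm x ≤ ptpNorm ((L₀ ^ m) x) := by
    intro m
    have hc : Continuous fun Φ : (H →L[ℂ] H) →L[ℂ] (H →L[ℂ] H) => ptpNorm ((Φ ^ m) x) :=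
      continuous_ptpNorm.comp
        ((ContinuousLinearMap.apply ℂ (H →L[ℂ] H) x).continuous.comp (continuous_pow m))
    exact ge_of_tendsto' ((hc.tendsto L₀).comp hAlim) fun n => hle n m
  have h0 : ptpNorm x ≤ ptpNorm (0 : H →L[ℂ] H) :=
    ge_of_tendsto' ((continuous_ptpNorm.tendsto 0).comp (hL₀.2.tendsto_pow_apply_zero hL₀.1 hx))
      hle'
  have h00 : ptpNorm (0 : H →L[ℂ] H) = 0 := by simp [ptpNorm]
  exact norm_le_zero_iff.1 ((norm_le_ptpNorm x).trans (h0.trans_eq h00))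

end Mean

/-! ### Convergence of Cesàro means -/

theorem HasNoUnimodularEigenvector.exists_norm_le (h : HasNoUnimodularEigenvector F) :
    ∃ C : ℝ, ∀ x, traceL H x = 0 → ‖x‖ ≤ C * ‖x - F x‖ := by
  let D : LinearMap.ker (traceL H) →ₗ[ℂ] (H →L[ℂ] H) :=
    (1 - (F : (H →L[ℂ] H) →ₗ[ℂ] (H →L[ℂ] H))).domRestrict _
  have hker : LinearMap.ker D = ⊥ := by
    rw [LinearMap.ker_eq_bot']
    intro y hy
    have : (y : H →L[ℂ] H) - F y = 0 := hy
    exact Subtype.ext (h.eq_zero_of_fixed y.2 (sub_eq_zero.1 this).symm)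
  obtain ⟨K, -, hK⟩ := D.exists_antilipschitzWith hker
  exact ⟨K, fun x hx => ZeroHomClass.bound_of_antilipschitz D hK ⟨x, hx⟩⟩

/-- If the increments `r (n + 1) - F (r n)` average to zero, then `r` averages to the fixed
point of `F`. -/
theorem tendsto_cesaro_of_tendsto_increments (h : HasNoUnimodularEigenvector F)
    {ρ : H →L[ℂ] H} (hρ1 : traceL H ρ = 1) (hρ : F ρ = ρ)
    {r : ℕ → H →L[ℂ] H} (hr1 : ∀ n, traceL H (r n) = 1) {C : ℝ} (hrC : ∀ n, ‖r n‖ ≤ C)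
    (hlim : Tendsto (fun N : ℕ => (N : ℂ)⁻¹ • ∑ n ∈ Finset.range N, (r (n + 1) - F (r n))) atTop
      (𝓝 0)) :
    Tendsto (fun N : ℕ => (N : ℂ)⁻¹ • ∑ n ∈ Finset.Icc 1 N, r n) atTop (𝓝 ρ) := by
  obtain ⟨K, hK⟩ := h.exists_norm_le
  have hIcc : ∀ N : ℕ, ∑ n ∈ Finset.Icc 1 N, r n = ∑ n ∈ Finset.range N, r (n + 1) := by
    intro N
    rw [Finset.range_eq_Ico, Finset.sum_Ico_add' r 0 N 1]
    rfl
  simp_rw [hIcc]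
  -- Boundary term from shifting the index in the sum of `F (r n)`.
  have hbd : Tendsto (fun N : ℕ => (N : ℂ)⁻¹ • (F (r N) - F (r 0))) atTop (𝓝 0) := by
    have h1 : Tendsto (fun N : ℕ => (N : ℝ)⁻¹ * (‖F‖ * C + ‖F‖ * C)) atTop (𝓝 0) := by
      simpa using tendsto_inv_atTop_nhds_zero_nat.mul_const (‖F‖ * C + ‖F‖ * C)
    refine squeeze_zero_norm (fun N => ?_) h1
    rw [norm_smul, norm_inv, Complex.norm_natCast]
    gcongr
    refine (norm_sub_le _ _).trans (add_le_add ?_ ?_)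
    · exact (F.le_opNorm _).trans (by gcongr; exact hrC N)
    · exact (F.le_opNorm _).trans (by gcongr; exact hrC 0)
  have hD := hlim.sub hbd
  rw [sub_zero] at hD
  rw [tendsto_iff_norm_sub_tendsto_zero]
  have hK0 := hD.norm.const_mul K
  rw [norm_zero, mul_zero] at hK0
  refine squeeze_zero' (Eventually.of_forall fun _ => norm_nonneg _) ?_ hK0
  filter_upwards [eventually_gt_atTop 0] with N hN
  have hN0 : (N : ℂ) ≠ 0 := by exact_mod_cast hN.ne'
  -- The average minus `ρ` is traceless, so it is controlled by its image under `1 - F`, which is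
  -- the mean increment minus the boundary term.
  refine (hK _ ?_).trans_eq ?_
  · rw [map_sub, map_smul, map_sum, hρ1]
    simp [hr1, hN0]
  · congr 2
    have hs : ∑ n ∈ Finset.range N, (r (n + 1) - F (r n)) - (F (r N) - F (r 0))
        = ∑ n ∈ Finset.range N, r (n + 1) - F (∑ n ∈ Finset.range N, r (n + 1)) := by
      rw [← Finset.sum_range_sub (fun n => F (r n)), ← Finset.sum_sub_distrib, map_sum,
        ← Finset.sum_sub_distrib]
      exact Finset.sum_congr rfl fun n _ => by abel
    rw [map_sub, hρ, sub_sub_sub_cancel_right, map_smul, ← smul_sub, ← smul_sub, hs]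

/-- The fixed point of trace one is a state. -/
theorem isState_of_fixed (hF : IsPositiveTracePreserving F) (h : HasNoUnimodularEigenvector F)
    [Nontrivial H] {ρ : H →L[ℂ] H} (hρ1 : traceL H ρ = 1) (hρ : F ρ = ρ) : IsState ρ := by
  refine ⟨?_, hρ1⟩
  have : CompleteSpace H := FiniteDimensional.complete ℂ H
  let ρ₀ : H →L[ℂ] H := (Module.finrank ℂ H : ℂ)⁻¹ • 1
  have hρ₀ : traceL H ρ₀ = 1 := by
    rw [map_smul, traceL_one, smul_eq_mul, inv_mul_cancel₀]
    exact_mod_cast Module.finrank_pos.ne'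
  have hsmul : ∀ {σ : H →L[ℂ] H} (n : ℕ), σ.IsPositive → ((n : ℂ)⁻¹ • σ).IsPositive := by
    intro σ n hσ
    refine hσ.smul_of_nonneg ?_
    rw [← Complex.ofReal_natCast, ← Complex.ofReal_inv]
    exact Complex.zero_le_real.2 (by positivity)
  have hρ₀p : ρ₀.IsPositive := hsmul _ ContinuousLinearMap.isPositive_one
  have hs : ∀ n : ℕ, ((F ^ n) ρ₀).IsPositive := fun n => (hF.pow n).isPositive _ hρ₀p
  -- The orbit of the maximally mixed state has zero increments, so `ρ` is a limit of positive
  -- averages.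
  have hlim := tendsto_cesaro_of_tendsto_increments h hρ1 hρ (r := fun n => (F ^ n) ρ₀)
    (fun n => ((hF.pow n).traceL_apply_eq ρ₀).trans hρ₀) (fun n => (hF.pow n).norm_apply_le ρ₀) (by
      have : ∀ n : ℕ, (F ^ (n + 1)) ρ₀ - F ((F ^ n) ρ₀) = 0 := fun n => by
        rw [pow_succ']
        exact sub_self _
      simp only [this, Finset.sum_const_zero, smul_zero]
      exact tendsto_const_nhds)
  refine isClosed_isPositive.mem_of_tendsto hlim (Eventually.of_forall fun N => ?_)
  refine hsmul N ?_
  exact Finset.sum_induction _ (fun σ : H →L[ℂ] H => σ.IsPositive) (fun _ _ ha hb => ha.add hb)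
    ContinuousLinearMap.isPositive_zero fun n _ => hs n

end RepeatedInteraction

/-! ### A strong law of large numbers for bounded orthogonal increments -/

section StrongLaw

theorem norm_sum_range_le {Ω G : Type*} [NormedAddCommGroup G] {D : ℕ → Ω → G} {C : ℝ}
    (hC : ∀ n ω, ‖D n ω‖ ≤ C) (n : ℕ) (ω : Ω) : ‖∑ k ∈ Finset.range n, D k ω‖ ≤ n * C := by
  refine (norm_sum_le_of_le _ fun k _ => hC k ω).trans_eq ?_
  simp

variable {Ω : Type*} [MeasurableSpace Ω] {P : Measure Ω} [IsProbabilityMeasure P]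
  {G : Type*} [NormedAddCommGroup G] [InnerProductSpace ℂ G] {D : ℕ → Ω → G} {C : ℝ}

/-- Pythagoras: the cross term integrates to zero, so each step adds at most `C ^ 2`. -/
theorem integral_norm_sum_sq_le (hm : ∀ n, AEStronglyMeasurable (D n) P)
    (hC : ∀ n ω, ‖D n ω‖ ≤ C)
    (horth : ∀ n, ∫ ω, inner ℂ (∑ k ∈ Finset.range n, D k ω) (D n ω) ∂P = 0) (n : ℕ) :
    ∫ ω, ‖∑ k ∈ Finset.range n, D k ω‖ ^ 2 ∂P ≤ n * C ^ 2 := by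
  have hSm : ∀ n, AEStronglyMeasurable (fun ω => ∑ k ∈ Finset.range n, D k ω) P := fun n =>
    Finset.aestronglyMeasurable_fun_sum _ fun k _ => hm k
  induction n with
  | zero => simp
  | succ n ih =>
    have hC0 : 0 ≤ C := by
      obtain ⟨ω⟩ := P.nonempty_of_neZero
      exact (norm_nonneg _).trans (hC 0 ω)
    have hi1 : Integrable (fun ω => ‖∑ k ∈ Finset.range n, D k ω‖ ^ 2) P :=
      Integrable.of_bound ((hSm n).norm.pow 2) ((n * C) ^ 2) (ae_of_all _ fun ω => by
        rw [norm_pow, norm_norm]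
        gcongr
        exact norm_sum_range_le hC n ω)
    have hi2 : Integrable (fun ω => inner ℂ (∑ k ∈ Finset.range n, D k ω) (D n ω)) P :=
      Integrable.of_bound ((hSm n).inner (hm n)) (n * C * C) (ae_of_all _ fun ω =>
        (norm_inner_le_norm _ _).trans (by
          gcongr
          · exact norm_sum_range_le hC n ω
          · exact hC n ω))
    have hi3 : Integrable (fun ω => ‖D n ω‖ ^ 2) P :=
      Integrable.of_bound ((hm n).norm.pow 2) (C ^ 2) (ae_of_all _ fun ω => by
        rw [norm_pow, norm_norm]
        gcongr
        exact hC n ω)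
    have hre : ∫ ω, (inner ℂ (∑ k ∈ Finset.range n, D k ω) (D n ω)).re ∂P = 0 := by
      have h := integral_re hi2
      simp only [RCLike.re_to_complex, horth n, Complex.zero_re] at h
      exact h
    have h3 : ∫ ω, ‖D n ω‖ ^ 2 ∂P ≤ C ^ 2 := by
      refine (integral_mono hi3 (integrable_const (C ^ 2)) fun ω => ?_).trans_eq (by simp)
      gcongr
      exact hC n ω
    have he : ∀ ω, ‖∑ k ∈ Finset.range (n + 1), D k ω‖ ^ 2 = ‖∑ k ∈ Finset.range n, D k ω‖ ^ 2
        + 2 * (inner ℂ (∑ k ∈ Finset.range n, D k ω) (D n ω)).re + ‖D n ω‖ ^ 2 := fun ω => by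
      rw [Finset.sum_range_succ, norm_add_sq (𝕜 := ℂ)]
      rfl
    simp_rw [he]
    have hi2' : Integrable
        (fun ω => 2 * (inner ℂ (∑ k ∈ Finset.range n, D k ω) (D n ω)).re) P := hi2.re.const_mul 2
    have hi12 : Integrable (fun ω => ‖∑ k ∈ Finset.range n, D k ω‖ ^ 2
        + 2 * (inner ℂ (∑ k ∈ Finset.range n, D k ω) (D n ω)).re) P := hi1.add hi2'
    rw [integral_add hi12 hi3, integral_add hi1 hi2', integral_const_mul, hre]
    push_cast
    linarith

theorem tendsto_natSqrt_atTop : Tendsto Nat.sqrt atTop atTop :=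
  tendsto_atTop_atTop.2 fun b => ⟨b * b, fun _ ha => Nat.le_sqrt.2 ha⟩

/-- At time `m ^ 2` the average has second moment at most `C ^ 2 / m ^ 2`. This is summable, so the
squared averages are almost surely summable. -/
theorem ae_tendsto_average_sq (hm : ∀ n, AEStronglyMeasurable (D n) P)
    (hC : ∀ n ω, ‖D n ω‖ ≤ C)
    (horth : ∀ n, ∫ ω, inner ℂ (∑ k ∈ Finset.range n, D k ω) (D n ω) ∂P = 0) :
    ∀ᵐ ω ∂P, Tendsto (fun m : ℕ => ((m ^ 2 : ℕ) : ℝ)⁻¹ * ‖∑ k ∈ Finset.range (m ^ 2), D k ω‖)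
      atTop (𝓝 0) := by
  let f : ℕ → Ω → ℝ := fun m ω => (((m ^ 2 : ℕ) : ℝ)⁻¹ * ‖∑ k ∈ Finset.range (m ^ 2), D k ω‖) ^ 2
  have hfm : ∀ m, AEStronglyMeasurable (f m) P := fun m =>
    (((Finset.aestronglyMeasurable_fun_sum _ fun k _ => hm k).norm).const_mul _).pow 2
  have hfi : ∀ m, Integrable (f m) P := fun m =>
    Integrable.of_bound (hfm m) ((((m ^ 2 : ℕ) : ℝ)⁻¹ * ((m ^ 2 : ℕ) * C)) ^ 2)
      (ae_of_all _ fun ω => by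
        rw [norm_pow, Real.norm_of_nonneg (by positivity)]
        gcongr
        exact norm_sum_range_le hC _ ω)
  have hint : ∀ m, ∫ ω, f m ω ∂P ≤ C ^ 2 * (1 / (m : ℝ) ^ 2) := by
    intro m
    simp only [f, mul_pow]
    rw [integral_const_mul]
    have h := integral_norm_sum_sq_le hm hC horth (m ^ 2)
    rcases Nat.eq_zero_or_pos m with rfl | hm0
    · simp
    · calc _ ≤ (((m ^ 2 : ℕ) : ℝ)⁻¹) ^ 2 * ((m ^ 2 : ℕ) * C ^ 2) := by gcongr
        _ = _ := by
          push_cast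
          field_simp
  have hsum : ∑' m, ∫⁻ ω, ENNReal.ofReal (f m ω) ∂P ≠ ⊤ := by
    have hs : Summable fun m : ℕ => C ^ 2 * (1 / (m : ℝ) ^ 2) :=
      (Real.summable_one_div_nat_pow.2 one_lt_two).mul_left _
    refine ne_top_of_le_ne_top hs.tsum_ofReal_ne_top (ENNReal.tsum_le_tsum fun m => ?_)
    rw [← ofReal_integral_eq_lintegral_ofReal (hfi m) (ae_of_all _ fun ω => sq_nonneg _)]
    exact ENNReal.ofReal_le_ofReal (hint m)
  have hmeas : ∀ m, AEMeasurable (fun ω => ENNReal.ofReal (f m ω)) P := fun m =>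
    (hfm m).aemeasurable.ennreal_ofReal
  rw [← lintegral_tsum hmeas] at hsum
  filter_upwards [ae_lt_top' (AEMeasurable.tsum hmeas) hsum] with ω hω
  have h0 := ENNReal.tendsto_atTop_zero_of_tsum_ne_top hω.ne
  have h1 : Tendsto (fun m => f m ω) atTop (𝓝 0) := by
    have h2 := (ENNReal.tendsto_toReal ENNReal.zero_ne_top).comp h0
    rw [ENNReal.toReal_zero] at h2
    exact h2.congr fun m => ENNReal.toReal_ofReal (sq_nonneg _)
  have h2 := h1.sqrt
  rw [Real.sqrt_zero] at h2
  exact h2.congr fun m => Real.sqrt_sq (by positivity)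

/-- With `m = ⌊√N⌋`, at most `2 * m` terms lie beyond `m ^ 2`, and they change the average by at
most `2 * C / m`. -/
theorem tendsto_average_of_tendsto_average_sq {d : ℕ → G} (hC : ∀ n, ‖d n‖ ≤ C)
    (h : Tendsto (fun m : ℕ => ((m ^ 2 : ℕ) : ℝ)⁻¹ * ‖∑ k ∈ Finset.range (m ^ 2), d k‖)
      atTop (𝓝 0)) :
    Tendsto (fun N : ℕ => (N : ℂ)⁻¹ • ∑ k ∈ Finset.range N, d k) atTop (𝓝 0) := by
  have hC0 : 0 ≤ C := (norm_nonneg _).trans (hC 0)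
  have h1 : Tendsto (fun m : ℕ => ((m ^ 2 : ℕ) : ℝ)⁻¹ * ‖∑ k ∈ Finset.range (m ^ 2), d k‖
      + 2 * C * (m : ℝ)⁻¹) atTop (𝓝 0) := by
    simpa using h.add (tendsto_inv_atTop_nhds_zero_nat.const_mul (2 * C))
  refine squeeze_zero_norm' ?_ (h1.comp tendsto_natSqrt_atTop)
  filter_upwards [tendsto_natSqrt_atTop.eventually_gt_atTop 0] with N hN
  simp only [Function.comp_apply]
  set m := Nat.sqrt N with hm
  have hm1 : m ^ 2 ≤ N := Nat.sqrt_le' N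
  have hm2 : N ≤ m ^ 2 + 2 * m := by
    have := Nat.sqrt_le_add N
    rw [← hm] at this
    linarith [pow_two m]
  have hmR : (0 : ℝ) < m := by exact_mod_cast hN
  have hm1R : (((m ^ 2 : ℕ) : ℝ)) ≤ N := by exact_mod_cast hm1
  have hpos : (0 : ℝ) < ((m ^ 2 : ℕ) : ℝ) := by push_cast; positivity
  have hle : ‖∑ k ∈ Finset.range N, d k‖ ≤ ‖∑ k ∈ Finset.range (m ^ 2), d k‖ + 2 * m * C := by
    rw [← Finset.sum_range_add_sum_Ico _ hm1]
    refine (norm_add_le _ _).trans (add_le_add le_rfl ?_)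
    refine (norm_sum_le_of_le _ fun k _ => hC k).trans ?_
    rw [Finset.sum_const, Nat.card_Ico, nsmul_eq_mul]
    gcongr
    have : N - m ^ 2 ≤ 2 * m := by omega
    exact_mod_cast this
  rw [norm_smul, norm_inv, Complex.norm_natCast]
  calc (N : ℝ)⁻¹ * ‖∑ k ∈ Finset.range N, d k‖
      ≤ ((m ^ 2 : ℕ) : ℝ)⁻¹ * (‖∑ k ∈ Finset.range (m ^ 2), d k‖ + 2 * m * C) := by
        gcongr
    _ = _ := by
        push_cast
        field_simp

theorem ae_tendsto_average_of_orthogonal (hm : ∀ n, AEStronglyMeasurable (D n) P)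
    (hC : ∀ n ω, ‖D n ω‖ ≤ C)
    (horth : ∀ n, ∫ ω, inner ℂ (∑ k ∈ Finset.range n, D k ω) (D n ω) ∂P = 0) :
    ∀ᵐ ω ∂P, Tendsto (fun N : ℕ => (N : ℂ)⁻¹ • ∑ k ∈ Finset.range N, D k ω) atTop (𝓝 0) := by
  filter_upwards [ae_tendsto_average_sq hm hC horth] with ω hω
  exact tendsto_average_of_tendsto_average_sq (fun n => hC n ω) hω

end StrongLaw

/-! ### Products of independent identically distributed elements of an algebra -/

/-- Resampling one coordinate preserves a product measure. -/
theorem measurePreserving_update_infinitePi {ι Ω₀ : Type*} [DecidableEq ι] [MeasurableSpace Ω₀]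
    (p : Measure Ω₀) [IsProbabilityMeasure p] (i : ι) :
    MeasurePreserving (fun q : (ι → Ω₀) × Ω₀ => Function.update q.1 i q.2)
      ((Measure.infinitePi fun _ : ι => p).prod p) (Measure.infinitePi fun _ : ι => p) := by
  refine ⟨measurable_update', Measure.eq_infinitePi _ fun s t ht => ?_⟩
  rw [Measure.map_apply measurable_update'
    (MeasurableSet.pi s.countable_toSet fun j _ => ht j)]
  by_cases hi : i ∈ s
  · have hpre : (fun q : (ι → Ω₀) × Ω₀ => Function.update q.1 i q.2) ⁻¹' (Set.pi s t)
        = (Set.pi (s.erase i : Finset ι) t) ×ˢ t i := by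
      ext q
      simp only [Set.mem_preimage, Set.mem_pi, Finset.mem_coe, Set.mem_prod, Finset.mem_erase]
      constructor
      · intro h
        refine ⟨fun j hj => ?_, ?_⟩
        · simpa [Function.update_of_ne hj.1] using h j hj.2
        · simpa using h i hi
      · rintro ⟨h1, h2⟩ j hj
        by_cases hji : j = i
        · subst hji; simpa using h2
        · simpa [Function.update_of_ne hji] using h1 j ⟨hji, hj⟩
    rw [hpre, Measure.prod_prod, Measure.infinitePi_pi _ fun j _ => ht j,
      Finset.prod_erase_mul _ _ hi]
  · have hpre : (fun q : (ι → Ω₀) × Ω₀ => Function.update q.1 i q.2) ⁻¹' (Set.pi s t)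
        = (Set.pi s t) ×ˢ Set.univ := by
      ext q
      simp only [Set.mem_preimage, Set.mem_pi, Finset.mem_coe, Set.mem_prod, Set.mem_univ, and_true]
      refine forall₂_congr fun j hj => ?_
      rw [Function.update_of_ne (ne_of_mem_of_not_mem hj hi)]
    rw [hpre, Measure.prod_prod, Measure.infinitePi_pi _ fun j _ => ht j, measure_univ, mul_one]

/-- The product `L (ω n) * ⋯ * L (ω 1)`. -/
noncomputable def randomProduct {Ω₀ A : Type*} [Monoid A] (L : Ω₀ → A) (ω : ℕ+ → Ω₀) : ℕ → A
  | 0 => 1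
  | n + 1 => L (ω n.succPNat) * randomProduct L ω n

/-- The first `n` factors use coordinates `1, …, n`, while `n.succPNat` is `n + 1`. -/
theorem randomProduct_update {Ω₀ A : Type*} [Monoid A] (L : Ω₀ → A) (ω : ℕ+ → Ω₀) (x : Ω₀)
    {n m : ℕ} (hmn : m ≤ n) :
    randomProduct L (Function.update ω n.succPNat x) m = randomProduct L ω m := by
  induction m with
  | zero => rfl
  | succ m ih =>
    have hne : m.succPNat ≠ n.succPNat := fun h => by
      have := Nat.succPNat_injective h
      omega
    rw [randomProduct, randomProduct, ih (by omega), Function.update_of_ne hne]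

section RandomProduct

variable {Ω₀ : Type*} [MeasurableSpace Ω₀] {p : Measure Ω₀} [IsProbabilityMeasure p]
  {A : Type*} [NormedRing A] [NormedAlgebra ℂ A] [FiniteDimensional ℂ A] [MeasurableSpace A]
  [BorelSpace A] {L : Ω₀ → A}

theorem measurable_randomProduct (hL : Measurable L) (n : ℕ) :
    Measurable fun ω => randomProduct L ω n := by
  have : ProperSpace A := FiniteDimensional.proper ℂ A
  induction n with
  | zero => exact measurable_const
  | succ n ih => exact (hL.comp (measurable_pi_apply _)).mul ih

theorem ae_tendsto_average_increments_randomProduct (hL : Measurable L) {F : A}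
    (hF : ∀ φ : A →L[ℂ] ℂ, ∫ ω, φ (L ω) ∂p = φ F) {C : ℝ} (hLC : ∀ ω, ‖L ω‖ ≤ C)
    (hC : ∀ n ω, ‖randomProduct L ω n‖ ≤ C) :
    ∀ᵐ ω ∂(Measure.infinitePi fun _ : ℕ+ => p), Tendsto (fun N : ℕ => (N : ℂ)⁻¹ •
      ∑ n ∈ Finset.range N, (randomProduct L ω (n + 1) - F * randomProduct L ω n)) atTop (𝓝 0) := by
  have : ProperSpace A := FiniteDimensional.proper ℂ A
  -- Orthogonality needs an inner product; in finite dimension any linear isomorphism with a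
  -- Euclidean space transports the limit.
  let T : A ≃L[ℂ] EuclideanSpace ℂ (Fin (Module.finrank ℂ A)) :=
    (LinearEquiv.ofFinrankEq A (EuclideanSpace ℂ (Fin (Module.finrank ℂ A)))
      (by simp)).toContinuousLinearEquiv
  have hTc : Continuous T := T.continuous
  let Tl : A →L[ℂ] EuclideanSpace ℂ (Fin (Module.finrank ℂ A)) := T
  let D : ℕ → (ℕ+ → Ω₀) → EuclideanSpace ℂ (Fin (Module.finrank ℂ A)) := fun n ω =>
    T ((L (ω n.succPNat) - F) * randomProduct L ω n)
  have hDm : ∀ n, Measurable (D n) := fun n =>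
    hTc.measurable.comp (((hL.comp (measurable_pi_apply _)).sub_const F).mul
      (measurable_randomProduct hL n))
  have hDC : ∀ n ω, ‖D n ω‖ ≤ ‖Tl‖ * ((C + ‖F‖) * C) := by
    intro n ω
    refine (Tl.le_opNorm _).trans ?_
    gcongr
    refine (norm_mul_le _ _).trans ?_
    have hC0 : 0 ≤ C := (norm_nonneg _).trans (hC 0 ω)
    gcongr
    · exact (norm_sub_le _ _).trans (by gcongr; exact hLC _)
    · exact hC n ω
  have horth : ∀ n, ∫ ω, inner ℂ (∑ k ∈ Finset.range n, D k ω) (D n ω)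
      ∂(Measure.infinitePi fun _ : ℕ+ => p) = 0 := by
    intro n
    let g : (ℕ+ → Ω₀) → ℂ := fun ω => inner ℂ (∑ k ∈ Finset.range n, D k ω) (D n ω)
    have hgm : Measurable g :=
      (Finset.measurable_fun_sum _ fun k _ => hDm k).inner (hDm n)
    have hgb : ∀ ω, ‖g ω‖ ≤ (n * (‖Tl‖ * ((C + ‖F‖) * C))) * (‖Tl‖ * ((C + ‖F‖) * C)) := by
      intro ω
      have h0 := (norm_nonneg _).trans (hDC 0 ω)
      refine (norm_inner_le_norm _ _).trans ?_
      gcongr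
      · exact norm_sum_range_le hDC n ω
      · exact hDC n ω
    -- Resampling coordinate `n + 1` plays the role of conditioning on the past.
    have hmp := measurePreserving_update_infinitePi p n.succPNat
    change ∫ ω, g ω ∂_ = 0
    have hgi : Integrable (fun q : (ℕ+ → Ω₀) × Ω₀ => g (Function.update q.1 n.succPNat q.2))
        ((Measure.infinitePi fun _ : ℕ+ => p).prod p) :=
      Integrable.of_bound (hgm.comp hmp.measurable).aestronglyMeasurable _
        (ae_of_all _ fun q => hgb _)
    rw [← hmp.map_eq, integral_map hmp.measurable.aemeasurable hgm.aestronglyMeasurable,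
      integral_prod _ hgi]
    refine integral_eq_zero_of_ae (ae_of_all _ fun ω => ?_)
    -- With the past fixed, the pairing is `φ (L x - F)` for a continuous functional `φ`, so `hF`
    -- makes its mean vanish.
    let φ : A →L[ℂ] ℂ := (innerSL ℂ (∑ k ∈ Finset.range n, D k ω)) ∘L Tl ∘L
      ((ContinuousLinearMap.mul ℂ A).flip (randomProduct L ω n))
    have hφ : ∀ x, g (Function.update ω n.succPNat x) = φ (L x) - φ F := by
      intro x
      rw [← map_sub]
      have h1 : ∑ k ∈ Finset.range n, D k (Function.update ω n.succPNat x)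
          = ∑ k ∈ Finset.range n, D k ω := by
        refine Finset.sum_congr rfl fun k hk => ?_
        have hk' := Finset.mem_range.1 hk
        have hne : k.succPNat ≠ n.succPNat := fun h => hk'.ne (Nat.succPNat_injective h)
        simp only [D]
        rw [randomProduct_update L ω x hk'.le, Function.update_of_ne hne]
      have h2 : D n (Function.update ω n.succPNat x) = T ((L x - F) * randomProduct L ω n) := by
        simp only [D]
        rw [randomProduct_update L ω x le_rfl, Function.update_self]
      simp only [g]
      rw [h1, h2]
      rfl
    have hφi : Integrable (fun x => φ (L x)) p :=
      Integrable.of_bound (φ.continuous.measurable.comp hL).aestronglyMeasurable (‖φ‖ * C)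
        (ae_of_all _ fun x => (φ.le_opNorm _).trans (by gcongr; exact hLC x))
    simp only [hφ, Pi.zero_apply]
    rw [integral_sub hφi (integrable_const _), hF φ, integral_const]
    simp
  filter_upwards [ae_tendsto_average_of_orthogonal (fun n => (hDm n).aestronglyMeasurable) hDC
    horth] with ω hω
  have h := (T.symm.continuous.tendsto 0).comp hω
  rw [map_zero] at h
  refine h.congr fun N => ?_
  simp only [Function.comp_apply, map_smul, map_sum, D, ContinuousLinearEquiv.symm_apply_apply,
    sub_mul]
  rfl

end RandomProduct

/-! ### Almost sure convergence of the trajectories -/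

namespace RepeatedInteraction

variable {H : Type u} [NormedAddCommGroup H] [InnerProductSpace ℂ H] {Ω₀ : Type*}
  {L : Ω₀ → (H →L[ℂ] H) →L[ℂ] (H →L[ℂ] H)}

theorem stateAt_eq_randomProduct (ω : ℕ+ → Ω₀) (ρ : H →L[ℂ] H) (n : ℕ) :
    stateAt L ω ρ n = randomProduct L ω n ρ := by
  induction n with
  | zero => rfl
  | succ n ih => rw [stateAt, randomProduct, ih]; rfl

theorem isPositiveTracePreserving_randomProduct (hP : ∀ ω, IsPositiveTracePreserving (L ω))
    (ω : ℕ+ → Ω₀) (n : ℕ) : IsPositiveTracePreserving (randomProduct L ω n) := by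
  induction n with
  | zero => exact .one
  | succ n ih => exact (hP _).mul ih

/-- Almost surely, the Cesàro means of `stateAt L ω ρ` converge to the fixed point of the mean,
for every state `ρ`. -/
theorem ae_tendsto_cesaro_stateAt [FiniteDimensional ℂ H] [MeasurableSpace Ω₀] {p : Measure Ω₀}
    [IsProbabilityMeasure p] (hL : Measurable L) (hP : ∀ ω, IsPositiveTracePreserving (L ω))
    (h : HasNoUnimodularEigenvector (∫ ω, L ω ∂p)) {ρplus : H →L[ℂ] H}
    (hρ1 : traceL H ρplus = 1) (hρ : (∫ ω, L ω ∂p) ρplus = ρplus) :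
    ∀ᵐ ω ∂(Measure.infinitePi fun _ : ℕ+ => p), ∀ ρ : H →L[ℂ] H, IsState ρ →
      Tendsto (fun N : ℕ => (N : ℂ)⁻¹ • ∑ n ∈ Finset.Icc 1 N, stateAt L ω ρ n) atTop
        (𝓝 ρplus) := by
  have hi : Integrable L p := integrable_of_isPositiveTracePreserving hL hP
  have hF : ∀ φ : ((H →L[ℂ] H) →L[ℂ] (H →L[ℂ] H)) →L[ℂ] ℂ,
      ∫ ω, φ (L ω) ∂p = φ (∫ ω, L ω ∂p) := fun φ => φ.integral_comp_comm hi
  -- The law is applied to the maps before `ρ` is chosen, so one null set serves all initial states.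
  filter_upwards [ae_tendsto_average_increments_randomProduct hL hF (fun ω => (hP ω).norm_le)
    fun n ω => (isPositiveTracePreserving_randomProduct hP ω n).norm_le] with ω hω ρ hρs
  simp_rw [stateAt_eq_randomProduct]
  refine tendsto_cesaro_of_tendsto_increments h hρ1 hρ
    (fun n => ((isPositiveTracePreserving_randomProduct hP ω n).traceL_apply_eq ρ).trans hρs.2)
    (fun n => (isPositiveTracePreserving_randomProduct hP ω n).norm_apply_le ρ) ?_
  have h1 := ((ContinuousLinearMap.apply ℂ (H →L[ℂ] H) ρ).continuous.tendsto 0).comp hω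
  rw [map_zero] at h1
  refine h1.congr fun N => ?_
  simp only [Function.comp_apply, map_smul, map_sum]
  rfl

end RepeatedInteraction

theorem mainTheorem2
    {H : Type u} [NormedAddCommGroup H] [InnerProductSpace ℂ H] [FiniteDimensional ℂ H]
    (hS : H →ₗ[ℂ] H) (hhS : hS.IsSymmetric)
    {Ω₀ : Type*} [MeasurableSpace Ω₀] (p : Measure Ω₀) [IsProbabilityMeasure p]
    (L : Ω₀ → (H →L[ℂ] H) →L[ℂ] (H →L[ℂ] H)) (hL_meas : Measurable L)
    (hL : ∀ ω₀, RepeatedInteraction.IsReducedDynamicsMap.{u, v} hS (L ω₀))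
    (hpos : 0 < p {ω₀ | L ω₀ ∈ RepeatedInteraction.ergodicMaps.{u, v} hS}) :
    Integrable L p ∧
    RepeatedInteraction.IsErgodic (∫ ω₀, L ω₀ ∂p) ∧
    ∃ ρplus : H →L[ℂ] H,
      (RepeatedInteraction.IsState ρplus ∧ (∫ ω₀, L ω₀ ∂p) ρplus = ρplus) ∧
      (∀ σ : H →L[ℂ] H, RepeatedInteraction.IsState σ → (∫ ω₀, L ω₀ ∂p) σ = σ → σ = ρplus) ∧
      ∃ Ωt : Set (ℕ+ → Ω₀), MeasurableSet Ωt ∧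
        Measure.infinitePi (fun _ : ℕ+ => p) Ωt = 1 ∧
        ∀ ω ∈ Ωt, ∀ ρ : H →L[ℂ] H, RepeatedInteraction.IsState ρ →
          Tendsto (fun N : ℕ => (N : ℂ)⁻¹ •
              ∑ n ∈ Finset.Icc 1 N, RepeatedInteraction.stateAt L ω ρ n)
            atTop (𝓝 ρplus) := by
  open RepeatedInteraction in
  have hP : ∀ ω, IsPositiveTracePreserving (L ω) := fun ω =>
    isReducedDynamicsMap_isPositiveTracePreserving (hL ω)
  have hpos' : 0 < p {ω | IsErgodic (L ω)} :=
    hpos.trans_le (measure_mono fun ω (hω : _ ∧ _) => hω.2)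
  have hne : Nontrivial H := by
    obtain ⟨ω, hω⟩ := nonempty_of_measure_ne_zero hpos'.ne'
    exact nontrivial_of_isErgodic hω
  have hF := isPositiveTracePreserving_integral (p := p) hL_meas hP
  have h := hasNoUnimodularEigenvector_integral hL_meas hP hpos'
  obtain ⟨ρplus, hρ1, hρ⟩ := exists_fixed_of_trace_one hF h
  refine ⟨integrable_of_isPositiveTracePreserving hL_meas hP,
    isErgodic_of_hasNoUnimodularEigenvector hF h, ρplus,
    ⟨isState_of_fixed hF h hρ1 hρ, hρ⟩, fun σ hσ hFσ => ?_, ?_⟩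
  -- The difference of two fixed states is a traceless fixed point.
  · refine sub_eq_zero.1 (h.eq_zero_of_fixed ?_ ?_)
    · rw [map_sub, hρ1, traceL_apply, hσ.2, sub_self]
    · rw [map_sub, hFσ, hρ]
  · have hae := ae_tendsto_cesaro_stateAt hL_meas hP h hρ1 hρ
    obtain ⟨t, ht, htm, ht1⟩ := hae.exists_measurable_mem
    exact ⟨t, htm, (prob_compl_eq_zero_iff htm).1 ht, ht1⟩
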